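/- A weighted graph is a set $V$ of vertices, finite or infinite, with a symmetric function $w:V\times V\to[0,\infty)$ such that $w_x:=\sum_{y} w(x,y)<\infty$ for every vertex $x$; its edges are the pairs with $w(x,y)>0$, and $w_z:=\sum_{x\in z}w_x$ for $z\subset V$. The random walk moves from $x$ to $y$ with probability $w(x,y)/w_x$. Let $o$ be a vertex with $w_o>0$ and let $z$ be a vertex set with graph distance $\mathrm{dist}(o,z)\ge n+1$ for some integer $n\ge 0$. Let $T_{oz}\in\{0,1,\dots\}\cup\{\infty\}$ be the first time at which the random walk started at $o$ is in $z$. Let $r_{oz}$ be the effective resistance between $o$ and $z$ in the electric network with conductances $w$, that is, the reciprocal of the infimum of $\frac12\sum_{x,y}w(x,y)(f(x)-f(y))^2$ over functions $f:V\to\mathbb R$ with $f(o)=1$ and $f=0$ on $z$; if $V$ is infinite, $r_{oz}$ may be either this free effective resistance or the wired one, in which only those $f$ are admitted that are constant outside a finite set. Let $g$ be either (a) a solution $g>1$ of $(g-1)^2g^{n-2}=2w_z/w_o$, or (b) $g=(w_z\,r_{oz})^{1/n}$, where $w_z r_{oz}<\infty$ (with $0\cdot\infty=0$; for $n=0$ read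 $g=1$, the value being immaterial). Let $T'_{0n}$ be the hitting time of $n$ for biased simple random walk on the integers started at $0$, which steps to the left with probability $1/(g+1)$ and to the right with probability $g/(g+1)$. Then for every $\lambda\ge 0$ $$\mathbf E\, e^{-\lambda (T'_{0n}+1)}\ \ge\ \mathbf E\, e^{-\lambda T_{oz}},$$ where $e^{-\lambda\cdot\infty}=0$ (also for $\lambda=0$). -/

import Mathlib

open MeasureTheory
open scoped ENNReal NNReal

noncomputable section

/-- A weighted graph on the vertex set `V` (finite or infinite): a symmetric nonnegative weight
function on pairs of vertices, loops allowed, with finite total weight at every vertex, so that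
the random walk is defined. -/
structure WeightedGraph (V : Type*) where
  weight : V → V → ℝ≥0
  symm : ∀ x y, weight x y = weight y x
  sum_ne_top : ∀ x, ∑' y, (weight x y : ℝ≥0∞) ≠ ⊤

namespace WeightedGraph

variable {V : Type*} (G : WeightedGraph V)

/-- The weight `w_x` of a vertex: the sum of the weights of the incident edges. -/
def vertexWeight (x : V) : ℝ≥0∞ := ∑' y, (G.weight x y : ℝ≥0∞)

/-- The weight `w_z` of a vertex set: the sum of the weights of its vertices. -/
def setWeight (z : Set V) : ℝ≥0∞ := ∑' x : z, G.vertexWeight x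

/-- The graph whose edges are the support of the weight function (loops do not affect the
graph distance and are left out). -/
def graph : SimpleGraph V where
  Adj x y := x ≠ y ∧ G.weight x y ≠ 0
  symm := ⟨fun x y h => ⟨h.1.symm, by rw [G.symm]; exact h.2⟩⟩
  loopless := ⟨fun _ h => h.1 rfl⟩

/-- Transition probabilities of the random walk: `w(x,y) / w_x`. -/
def transition (x y : V) : ℝ≥0∞ := (G.weight x y : ℝ≥0∞) / G.vertexWeight x

/-- The Dirichlet energy `½ ∑_{x,y} w(x,y) (f x - f y)²` of a potential. -/
def energy (f : V → ℝ) : ℝ≥0∞ :=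
  (∑' x, ∑' y, (G.weight x y : ℝ≥0∞) * ENNReal.ofReal ((f x - f y) ^ 2)) / 2

/-- The (free) effective resistance between `o` and `z` in the electric network whose
conductances are the edge weights: the reciprocal of the least energy of a potential that is `1`
at `o` and `0` on `z`. -/
def freeResistance (o : V) (z : Set V) : ℝ≥0∞ :=
  (⨅ f ∈ {f : V → ℝ | f o = 1 ∧ ∀ y ∈ z, f y = 0}, G.energy f)⁻¹

/-- The wired effective resistance between `o` and `z`: only potentials that are constant outside
a finite set compete. On a finite graph it is the same as the free one. -/
def wiredResistance (o : V) (z : Set V) : ℝ≥0∞ :=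
  (⨅ f ∈ {f : V → ℝ | f o = 1 ∧ (∀ y ∈ z, f y = 0) ∧ ∃ c, {x | f x ≠ c}.Finite}, G.energy f)⁻¹

end WeightedGraph

/-- Transition probabilities of biased simple random walk on the integers with odds `1` and `g`
of going left and right. -/
def biasedTransition (g : ℝ) (i j : ℤ) : ℝ≥0∞ :=
  if j = i + 1 then ENNReal.ofReal (g / (g + 1))
  else if j = i - 1 then ENNReal.ofReal (1 / (g + 1))
  else 0

/-- Under `P`, the process `X` is a Markov chain on `V` (a set with discrete σ-algebra) with
transition probabilities `K`, started at `o`. -/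
structure IsMarkovChain {V Ω : Type*} [MeasurableSpace Ω] (P : Measure Ω)
    (K : V → V → ℝ≥0∞) (o : V) (X : ℕ → Ω → V) : Prop where
  measurable : ∀ k, Measurable[_, ⊤] (X k)
  start : ∀ᵐ ω ∂P, X 0 ω = o
  step : ∀ (k : ℕ) (x : ℕ → V),
    P {ω | ∀ i ≤ k + 1, X i ω = x i} = P {ω | ∀ i ≤ k, X i ω = x i} * K (x k) (x (k + 1))

/-- The first time at which the process is in the set `A`, `⊤` if it never is. -/
def hittingTime {V Ω : Type*} (X : ℕ → Ω → V) (A : Set V) (ω : Ω) : ℕ∞ :=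
  ⨅ (k : ℕ) (_ : X k ω ∈ A), (k : ℕ∞)

/-- `e^{-l t}` for a possibly infinite time `t`, with `e^{-l ∞} = 0` (also for `l = 0`). -/
def expNeg (l : ℝ) (t : ℕ∞) : ℝ :=
  open Classical in if t = ⊤ then 0 else Real.exp (-l * (t.toNat : ℝ))

/-- The Laplace transform `E e^{-l T}` of a random time. -/
def laplace {Ω : Type*} [MeasurableSpace Ω] (P : Measure Ω) (T : Ω → ℕ∞) (l : ℝ) : ℝ :=
  ∫ ω, expNeg l (T ω) ∂P

end

/-! Put `s = e^{-λ}` with `0 < s < 1`; the case `λ = 0` is a limit. Killing the walk outside a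
finite vertex set and exhausting the graph reduces the claim to a finite network with hitting
function `φ x = E_x s^T` and symmetric Green function `u` with pole `o`. Write `φ o = s * m ^ n`,
one factor `s` being set aside for the extra step. For the biased walk, `m ^ j` is a subsolution of
the discounted hitting equation at distance `j` from `n` as soon as `(g + 1) * m ≤ s * (g + m ^ 2)`,
so this inequality is what must be shown (`exists_mean_step`).

It comes from varying the discount. The derivative of `log (φ o)` in `log s` is the mean of `T`
under the law weighted by `s ^ T`. Hence `H s = s * (g / m + m)` is antitone if, under that law, the
mean number of steps before the last is at least `n * (g + m ^ 2) / (g - m ^ 2)`, which is the value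
for the biased walk with stage discount `m` (`StepBound`). Since `m < 1` and `m ≤ g`, also `H s ≥ s
* (g + 1)`; letting the discount tend to 1 gives `H ≥ g + 1` everywhere.

To count steps, let `a = s c(x,y) u(x) φ(y)` and `b = s c(x,y) u(y) φ(x)` be the weighted numbers of
crossings of an edge in its two directions. Then `a - b` is a flow of strength `φ o` from `o` to the
target, `log (a / b)` is the difference of the potential `log (u / φ)`, and `a + b = (a - b) coth
(log (a / b) / 2)`. As `coth` is convex on the positive axis, few crossings require a large drop of
potential. The flow crosses `n` levels of the distance, and by Jensen the mean drop is at most the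
logarithm of `s² w_z u(o) / φ(o)²`. The tangent at `log q`, `q = g / m ^ 2`, gives the bound.

In case (b), `u o` is at most the resistance (`sum_steps_ge_of_drop`). In case (a), `u o` is not
bounded, but if `R = w_o u(o)` is large, then many steps are spent at `o` itself; the edges at `o`
are therefore counted exactly (`sum_steps_ge_of_pole`) and the resulting bound holds for every `R >
1`. -/

/-! ### Discounted potential theory of a finite killed network -/

/-- A finite network with symmetric conductances `c` between interior vertices, conductance `b`
from each interior vertex to the target, and vertex weights `W` that dominate the total
conductance; the excess is the rate of killing. -/
structure KilledNetwork (ι : Type*) [Fintype ι] where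
  c : ι → ι → ℝ
  c_nonneg : ∀ x y, 0 ≤ c x y
  c_symm : ∀ x y, c x y = c y x
  W : ι → ℝ
  W_pos : ∀ x, 0 < W x
  b : ι → ℝ
  b_nonneg : ∀ x, 0 ≤ b x
  sum_le : ∀ x, ∑ y, c x y + b x ≤ W x

namespace KilledNetwork

variable {ι : Type*} [Fintype ι] (N : KilledNetwork ι)

/-- The discounted Laplacian. -/
def op (s : ℝ) (f : ι → ℝ) (x : ι) : ℝ := N.W x * f x - s * ∑ y, N.c x y * f y

/-- `φ` is the discounted hitting function of the target. -/
def IsHit (s : ℝ) (φ : ι → ℝ) : Prop := ∀ x, N.op s φ x = s * N.b x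

/-- `u` is the discounted Green function with pole `o`, divided by the vertex weights. -/
def IsGreen (s : ℝ) (o : ι) (u : ι → ℝ) : Prop :=
  open Classical in ∀ x, N.op s u x = if x = o then 1 else 0

theorem sum_c_le (x : ι) : ∑ y, N.c x y ≤ N.W x := by
  linarith [N.sum_le x, N.b_nonneg x]

/-- Minimum principle: at a negative minimum the average over neighbours is no smaller, and the
discount makes the operator strictly negative there. -/
theorem nonneg_of_op_nonneg {s : ℝ} (hs0 : 0 ≤ s) (hs1 : s < 1) {f : ι → ℝ}
    (h : ∀ x, 0 ≤ N.op s f x) (x : ι) : 0 ≤ f x := by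
  obtain ⟨x₀, -, hx₀⟩ := Finset.exists_min_image Finset.univ f ⟨x, Finset.mem_univ x⟩
  suffices 0 ≤ f x₀ from this.trans (hx₀ x (Finset.mem_univ x))
  by_contra! hneg
  have h1 : (∑ y, N.c x₀ y) * f x₀ ≤ ∑ y, N.c x₀ y * f y := by
    rw [Finset.sum_mul]
    exact Finset.sum_le_sum fun y _ =>
      mul_le_mul_of_nonneg_left (hx₀ y (Finset.mem_univ y)) (N.c_nonneg _ _)
  have h2 : N.W x₀ * f x₀ ≤ (∑ y, N.c x₀ y) * f x₀ :=
    mul_le_mul_of_nonpos_right (N.sum_c_le x₀) hneg.le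
  have h3 := h x₀
  unfold op at h3
  have h4 : s * (N.W x₀ * f x₀) ≤ s * ∑ y, N.c x₀ y * f y :=
    mul_le_mul_of_nonneg_left (h2.trans h1) hs0
  have h5 : N.W x₀ * f x₀ < 0 := mul_neg_of_pos_of_neg (N.W_pos _) hneg
  nlinarith

/-- The discounted Laplacian as a linear map. -/
def opLin (s : ℝ) : (ι → ℝ) →ₗ[ℝ] (ι → ℝ) where
  toFun f := N.op s f
  map_add' f g := by
    funext x
    simp only [op, Pi.add_apply, mul_add, Finset.sum_add_distrib]
    ring
  map_smul' r f := by
    funext x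
    simp only [op, Pi.smul_apply, smul_eq_mul, RingHom.id_apply, mul_sub, Finset.mul_sum]
    congr 1
    · ring
    · exact Finset.sum_congr rfl fun y _ => by ring

/-- The minimum principle gives injectivity, hence surjectivity in finite dimension. -/
theorem exists_op_eq {s : ℝ} (hs0 : 0 ≤ s) (hs1 : s < 1) (h : ι → ℝ) : ∃ f, N.op s f = h := by
  have inj : Function.Injective (N.opLin s) := by
    rw [← LinearMap.ker_eq_bot, LinearMap.ker_eq_bot']
    intro f hf
    have h1 : ∀ x, N.op s f x = 0 := fun x => congrFun hf x
    have h2 : ∀ x, N.op s (-f) x = 0 := fun x =>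
      (congrFun ((N.opLin s).map_neg f) x).trans (by rw [hf]; simp)
    funext x
    have := N.nonneg_of_op_nonneg hs0 hs1 (fun x => (h1 x).ge) x
    have := N.nonneg_of_op_nonneg hs0 hs1 (fun x => (h2 x).ge) x
    simp only [Pi.neg_apply, Pi.zero_apply] at *
    linarith
  exact (LinearMap.injective_iff_surjective.mp inj) h

theorem sum_mul_op_comm (s : ℝ) (f g : ι → ℝ) :
    ∑ x, f x * N.op s g x = ∑ x, g x * N.op s f x := by
  have h : ∑ x, ∑ y, f x * (N.c x y * g y) = ∑ x, ∑ y, g x * (N.c x y * f y) := by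
    rw [Finset.sum_comm]
    refine Finset.sum_congr rfl fun x _ => Finset.sum_congr rfl fun y _ => ?_
    rw [N.c_symm y x]; ring
  simp only [op, mul_sub, Finset.sum_sub_distrib]
  congr 1
  · exact Finset.sum_congr rfl fun x _ => by ring
  · simp only [mul_left_comm _ s, ← Finset.mul_sum] at h ⊢
    rw [h]

/-- Symmetry of the conductances moves the operator onto `u`, where it is a point mass. -/
theorem IsGreen.sum_mul_op {N : KilledNetwork ι} {s : ℝ} {o : ι} {u : ι → ℝ}
    (hu : N.IsGreen s o u) (f : ι → ℝ) : ∑ x, u x * N.op s f x = f o := by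
  classical
  rw [sum_mul_op_comm]
  simp [hu _]

section

variable {N} {s : ℝ} {o : ι} {u φ : ι → ℝ}

theorem IsHit.nonneg (hφ : N.IsHit s φ) (hs0 : 0 ≤ s) (hs1 : s < 1) (x : ι) : 0 ≤ φ x :=
  N.nonneg_of_op_nonneg hs0 hs1 (fun x => by rw [hφ x]; exact mul_nonneg hs0 (N.b_nonneg x)) x

theorem IsHit.le (hφ : N.IsHit s φ) (hs0 : 0 ≤ s) (hs1 : s < 1) (x : ι) : φ x ≤ s := by
  suffices 0 ≤ s - φ x by linarith
  refine N.nonneg_of_op_nonneg (f := fun x => s - φ x) hs0 hs1 (fun x => ?_) x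
  have h := hφ x
  have hW := N.sum_le x
  have hc : 0 ≤ ∑ y, N.c x y := Finset.sum_nonneg fun y _ => N.c_nonneg x y
  simp only [op, mul_sub, Finset.sum_sub_distrib, ← Finset.sum_mul] at h ⊢
  nlinarith [mul_nonneg hs0 (sub_nonneg.2 hW), mul_nonneg (mul_nonneg hs0 hc) (sub_nonneg.2 hs1.le)]

theorem IsGreen.nonneg (hu : N.IsGreen s o u) (hs0 : 0 ≤ s) (hs1 : s < 1) (x : ι) : 0 ≤ u x :=
  N.nonneg_of_op_nonneg hs0 hs1 (fun x => by rw [hu x]; split_ifs <;> norm_num) x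

theorem IsHit.W_mul (hφ : N.IsHit s φ) (x : ι) :
    N.W x * φ x = s * ∑ y, N.c x y * φ y + s * N.b x := by
  have := hφ x
  unfold op at this
  linarith

theorem IsGreen.W_mul_self (hu : N.IsGreen s o u) :
    N.W o * u o = s * ∑ y, N.c o y * u y + 1 := by
  have := hu o
  simp only [op, if_true] at this
  linarith

theorem IsGreen.W_mul_of_ne (hu : N.IsGreen s o u) {x : ι} (hx : x ≠ o) :
    N.W x * u x = s * ∑ y, N.c x y * u y := by
  have := hu x
  simp only [op, if_neg hx] at this
  linarith

theorem IsGreen.le_pole (hu : N.IsGreen s o u) (hs0 : 0 ≤ s) (hs1 : s < 1) (x : ι) :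
    u x ≤ u o := by
  obtain ⟨x₀, -, hx₀⟩ := Finset.exists_max_image Finset.univ u ⟨x, Finset.mem_univ x⟩
  refine (hx₀ x (Finset.mem_univ x)).trans ?_
  by_cases h : x₀ = o
  · rw [h]
  refine le_trans ?_ (hu.nonneg hs0 hs1 o)
  have h0 := hu.nonneg hs0 hs1 x₀
  have h1 : ∑ y, N.c x₀ y * u y ≤ (∑ y, N.c x₀ y) * u x₀ := by
    rw [Finset.sum_mul]
    exact Finset.sum_le_sum fun y _ =>
      mul_le_mul_of_nonneg_left (hx₀ y (Finset.mem_univ y)) (N.c_nonneg _ _)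
  have h2 : (∑ y, N.c x₀ y) * u x₀ ≤ N.W x₀ * u x₀ :=
    mul_le_mul_of_nonneg_right (N.sum_c_le x₀) h0
  have h3 := hu.W_mul_of_ne h
  have h4 := mul_le_mul_of_nonneg_left (h1.trans h2) hs0
  by_contra! hpos
  nlinarith [mul_pos (N.W_pos x₀) hpos]

theorem IsGreen.pole_pos (hu : N.IsGreen s o u) (hs0 : 0 ≤ s) (hs1 : s < 1) : 0 < u o := by
  have h := hu.W_mul_self
  have : 0 ≤ s * ∑ y, N.c o y * u y := mul_nonneg hs0 <|
    Finset.sum_nonneg fun y _ => mul_nonneg (N.c_nonneg _ _) (hu.nonneg hs0 hs1 y)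
  exact pos_of_mul_pos_right (by linarith : 0 < N.W o * u o) (N.W_pos o).le

/-- Decomposition by the vertex from which the target is entered; the summands are the weights of
the last step. -/
theorem IsGreen.hit_pole_eq (hu : N.IsGreen s o u) (hφ : N.IsHit s φ) :
    φ o = ∑ x, s * u x * N.b x := by
  rw [← hu.sum_mul_op φ]
  exact Finset.sum_congr rfl fun x _ => by rw [hφ x]; ring

/-- Positivity of the Green function spreads along edges. -/
theorem IsGreen.pos_of_adj (hu : N.IsGreen s o u) (hs0 : 0 < s) (hs1 : s < 1) {x y : ι}
    (hx : 0 < u x) (hxy : N.c x y ≠ 0) : 0 < u y := by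
  have hc : 0 < N.c y x := by
    rw [N.c_symm]; exact lt_of_le_of_ne (N.c_nonneg _ _) hxy.symm
  have h1 : N.c y x * u x ≤ ∑ z, N.c y z * u z :=
    Finset.single_le_sum (f := fun z => N.c y z * u z)
      (fun z _ => mul_nonneg (N.c_nonneg _ _) (hu.nonneg hs0.le hs1 z)) (Finset.mem_univ x)
  have h2 : 0 ≤ N.op s u y := by rw [hu y]; split_ifs <;> norm_num
  have h3 : 0 < N.W y * u y := by
    unfold op at h2
    have := mul_pos hs0 ((mul_pos hc hx).trans_le h1)
    linarith
  exact pos_of_mul_pos_right h3 (N.W_pos y).le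

/-- Positivity of the hitting function spreads along edges. -/
theorem IsHit.pos_of_adj (hφ : N.IsHit s φ) (hs0 : 0 < s) (hs1 : s < 1) {x y : ι}
    (hx : 0 < φ x) (hxy : N.c x y ≠ 0) : 0 < φ y := by
  have hc : 0 < N.c y x := by
    rw [N.c_symm]; exact lt_of_le_of_ne (N.c_nonneg _ _) hxy.symm
  have h1 : N.c y x * φ x ≤ ∑ z, N.c y z * φ z :=
    Finset.single_le_sum (f := fun z => N.c y z * φ z)
      (fun z _ => mul_nonneg (N.c_nonneg _ _) (hφ.nonneg hs0.le hs1 z)) (Finset.mem_univ x)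
  have h2 := hφ.W_mul y
  have h3 : 0 < N.W y * φ y := by
    have := mul_pos hs0 ((mul_pos hc hx).trans_le h1)
    have := mul_nonneg hs0.le (N.b_nonneg y)
    linarith
  exact pos_of_mul_pos_right h3 (N.W_pos y).le

theorem IsHit.pos_of_b (hφ : N.IsHit s φ) (hs0 : 0 < s) (hs1 : s < 1) {x : ι}
    (hx : N.b x ≠ 0) : 0 < φ x := by
  have hb : 0 < N.b x := lt_of_le_of_ne (N.b_nonneg _) hx.symm
  have h1 : 0 ≤ ∑ z, N.c x z * φ z :=
    Finset.sum_nonneg fun z _ => mul_nonneg (N.c_nonneg _ _) (hφ.nonneg hs0.le hs1 z)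
  have h2 := hφ.W_mul x
  have h3 : 0 < N.W x * φ x := by
    have := mul_pos hs0 hb
    have := mul_nonneg hs0.le h1
    linarith
  exact pos_of_mul_pos_right h3 (N.W_pos x).le

/-- Resolvent identity for the hitting function. -/
theorem IsGreen.hit_sub (hu : N.IsGreen s o u) (hφ : N.IsHit s φ) {t : ℝ} {χ : ι → ℝ}
    (hχ : N.IsHit t χ) (ht : t ≠ 0) :
    χ o - φ o = (1 - s / t) * ∑ x, N.W x * u x * χ x := by
  have h : ∑ x, u x * N.op s (fun x => χ x - φ x) x = χ o - φ o := hu.sum_mul_op _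
  rw [← h, Finset.mul_sum]
  refine Finset.sum_congr rfl fun x _ => ?_
  have h1 := hφ.W_mul x
  have h2 := hχ.W_mul x
  simp only [op, mul_sub, Finset.sum_sub_distrib]
  have h3 : ∑ y, N.c x y * χ y = N.W x * χ x / t - N.b x := by
    field_simp; linarith
  rw [h3, h1]
  field_simp
  ring

end

/-! ### Dependence of the hitting function on the discount -/

theorem tendsto_hit {φ : ℝ → ι → ℝ} (hφ : ∀ s, 0 < s → s < 1 → N.IsHit s (φ s)) {s : ℝ}
    (hs0 : 0 < s) (hs1 : s < 1) (x : ι) :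
    Filter.Tendsto (fun t => φ t x) (nhds s) (nhds (φ s x)) := by
  obtain ⟨u, hu'⟩ := N.exists_op_eq hs0.le hs1 (open Classical in fun y => if y = x then 1 else 0)
  have hu : N.IsGreen s x u := fun y => congrFun hu' y
  have hu0 := hu.nonneg hs0.le hs1
  rw [tendsto_iff_dist_tendsto_zero]
  have hlim : Filter.Tendsto (fun t => |1 - s / t| * ∑ x, N.W x * u x) (nhds s) (nhds 0) := by
    have : ContinuousAt (fun t => |1 - s / t| * ∑ x, N.W x * u x) s := by
      fun_prop (disch := exact hs0.ne')
    have h := this.tendsto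
    simpa [hs0.ne'] using h
  refine squeeze_zero' (Filter.Eventually.of_forall fun _ => dist_nonneg) ?_ hlim
  filter_upwards [Ioo_mem_nhds hs0 hs1] with t ht
  rw [Real.dist_eq, hu.hit_sub (hφ s hs0 hs1) (hφ t ht.1 ht.2) ht.1.ne', abs_mul]
  refine mul_le_mul_of_nonneg_left ?_ (abs_nonneg _)
  have h0 := fun y => (hφ t ht.1 ht.2).nonneg ht.1.le ht.2 y
  have h1 := fun y => ((hφ t ht.1 ht.2).le ht.1.le ht.2 y).trans ht.2.le
  rw [abs_of_nonneg (Finset.sum_nonneg fun y _ =>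
    mul_nonneg (mul_nonneg (N.W_pos y).le (hu0 y)) (h0 y))]
  exact Finset.sum_le_sum fun y _ =>
    mul_le_of_le_one_right (mul_nonneg (N.W_pos y).le (hu0 y)) (h1 y)

/-- The resolvent identity gives the difference quotient exactly, so continuity of the hitting
function suffices. Divided by `φ s o`, the sum is the mean hitting time under the law weighted by `s
^ T`. -/
theorem hasDerivAt_hit {φ : ℝ → ι → ℝ} (hφ : ∀ s, 0 < s → s < 1 → N.IsHit s (φ s)) {s : ℝ}
    (hs0 : 0 < s) (hs1 : s < 1) {o : ι} {u : ι → ℝ} (hu : N.IsGreen s o u) :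
    HasDerivAt (fun t => φ t o) ((∑ x, N.W x * u x * φ s x) / s) s := by
  rw [hasDerivAt_iff_tendsto_slope]
  have hlim : Filter.Tendsto (fun t => (∑ x, N.W x * u x * φ t x) / t) (nhdsWithin s {s}ᶜ)
      (nhds ((∑ x, N.W x * u x * φ s x) / s)) := by
    refine Filter.Tendsto.mono_left ?_ nhdsWithin_le_nhds
    refine Filter.Tendsto.div ?_ Filter.tendsto_id hs0.ne'
    exact tendsto_finsetSum _ fun x _ => (N.tendsto_hit hφ hs0 hs1 x).const_mul _
  refine hlim.congr' ?_
  filter_upwards [self_mem_nhdsWithin, mem_nhdsWithin_of_mem_nhds (Ioo_mem_nhds hs0 hs1)]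
    with t hts ht
  have hts' : t - s ≠ 0 := sub_ne_zero.2 hts
  have ht0 := ht.1.ne'
  rw [slope_def_field, hu.hit_sub (hφ s hs0 hs1) (hφ t ht.1 ht.2) ht.1.ne']
  field_simp

end KilledNetwork

/-! ### Convexity inequalities for the two crossing numbers of an edge -/

/-- The tangent-line bound for the convex function `coth (D / 2)` at `D = log q`, in homogeneous
form. -/
theorem tangent_mul_abs_sub_le_add {q a b : ℝ} (hq : 1 < q) (ha : 0 < a) (hb : 0 < b) :
    ((q + 1) / (q - 1) + 2 * q / (q - 1) ^ 2 * Real.log q) * |a - b|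
      - 2 * q / (q - 1) ^ 2 * ((a - b) * (Real.log a - Real.log b)) ≤ a + b := by
  wlog hab : b ≤ a generalizing a b
  · have := this hb ha (le_of_not_ge hab)
    rw [abs_sub_comm, add_comm a b]
    convert this using 2
    ring
  have hq1 : 0 < q - 1 := by linarith
  rw [abs_of_nonneg (sub_nonneg.2 hab)]
  -- Equality holds on the ray `a = q * b`, the point of tangency; the error left over in `h2` is a
  -- square.
  have hlog : Real.log q - (Real.log a - Real.log b) ≤ q * b / a - 1 := by
    have := Real.log_le_sub_one_of_pos (show 0 < q * b / a by positivity)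
    rw [Real.log_div (by positivity) ha.ne', Real.log_mul (by positivity) hb.ne'] at this
    linarith
  have h1 : 2 * q / (q - 1) ^ 2 * (a - b) * (Real.log q - (Real.log a - Real.log b)) ≤
      2 * q / (q - 1) ^ 2 * (a - b) * (q * b / a - 1) :=
    mul_le_mul_of_nonneg_left hlog (mul_nonneg (by positivity) (sub_nonneg.2 hab))
  have h2 : 2 * q / (q - 1) ^ 2 * (a - b) * (q * b / a - 1) =
      2 * (q * b - a) / (q - 1) - 2 * (q * b - a) ^ 2 / ((q - 1) ^ 2 * a) := by
    field_simp
    ring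
  have h3 : 0 ≤ 2 * (q * b - a) ^ 2 / ((q - 1) ^ 2 * a) := by positivity
  have h4 : (q + 1) / (q - 1) * (a - b) + 2 * (q * b - a) / (q - 1) = a + b := by
    field_simp
    ring
  nlinarith

/-- The tangent-plane bound for the convex function `(a - b) log (a / b)`. -/
theorem tangent_le_sub_mul_log_sub {r a b : ℝ} (hr : 0 < r) (ha : 0 < a) (hb : 0 < b) :
    (a - b) * Real.log r + (1 - r⁻¹) * a + (1 - r) * b ≤ (a - b) * (Real.log a - Real.log b) := by
  have h1 := Real.log_le_sub_one_of_pos (show 0 < r * b / a by positivity)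
  have h2 := Real.log_le_sub_one_of_pos (show 0 < a / (r * b) by positivity)
  rw [Real.log_div (by positivity) ha.ne', Real.log_mul (by positivity) hb.ne'] at h1
  rw [Real.log_div ha.ne' (by positivity), Real.log_mul (by positivity) hb.ne'] at h2
  have h3 := mul_le_mul_of_nonneg_left h1 ha.le
  have h4 := mul_le_mul_of_nonneg_left h2 hb.le
  have h5 : a * (r * b / a - 1) = r * b - a := by field_simp
  have h6 : b * (a / (r * b) - 1) = r⁻¹ * a - b := by field_simp
  rw [h5] at h3
  rw [h6] at h4
  nlinarith

/-! ### Flow, potential and the number of steps -/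

namespace KilledNetwork

variable {ι : Type*} [Fintype ι] (N : KilledNetwork ι)

/-- The net flow, up to normalization, of the walk conditioned to hit the target. -/
def flow (s : ℝ) (u φ : ι → ℝ) (x y : ι) : ℝ := s * N.c x y * (u x * φ y - u y * φ x)

variable {N} {s : ℝ} {o : ι} {u φ : ι → ℝ}

theorem flow_antisymm (x y : ι) : N.flow s u φ y x = -N.flow s u φ x y := by
  simp only [flow, N.c_symm y x]; ring

/-- The divergence: a source of strength `φ o` at the pole, drained at the vertices next to the
target. -/
theorem sum_flow (hu : N.IsGreen s o u) (hφ : N.IsHit s φ) (x : ι) [Decidable (x = o)] :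
    ∑ y, N.flow s u φ x y = (if x = o then φ o else 0) - s * u x * N.b x := by
  have h1 := hφ.W_mul x
  have h2 : ∑ y, N.flow s u φ x y =
      u x * (s * ∑ y, N.c x y * φ y) - φ x * (s * ∑ y, N.c x y * u y) := by
    simp only [Finset.mul_sum, ← Finset.sum_sub_distrib]
    exact Finset.sum_congr rfl fun y _ => by unfold flow; ring
  rw [h2]
  split_ifs with h
  · subst h
    have h3 := hu.W_mul_self
    linear_combination φ x * h3 - u x * h1
  · have h3 := hu.W_mul_of_ne h
    linear_combination φ x * h3 - u x * h1

theorem sum_flow_mul_sub (hu : N.IsGreen s o u) (hφ : N.IsHit s φ) (f : ι → ℝ) :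
    ∑ x, ∑ y, N.flow s u φ x y * (f x - f y) =
      2 * (f o * φ o - ∑ x, s * u x * N.b x * f x) := by
  classical
  have h1 : ∑ x, ∑ y, N.flow s u φ x y * f y = -∑ x, ∑ y, N.flow s u φ x y * f x := by
    rw [Finset.sum_comm, ← Finset.sum_neg_distrib]
    refine Finset.sum_congr rfl fun x _ => ?_
    rw [← Finset.sum_neg_distrib]
    exact Finset.sum_congr rfl fun y _ => by rw [flow_antisymm]; ring
  have h2 : ∑ x, ∑ y, N.flow s u φ x y * f x = f o * φ o - ∑ x, s * u x * N.b x * f x := by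
    simp only [← Finset.sum_mul, sum_flow hu hφ, sub_mul, Finset.sum_sub_distrib]
    simp [mul_comm]
  simp only [mul_sub, Finset.sum_sub_distrib, h1, h2]
  ring

/-- The potential of the walk conditioned to hit the target. -/
noncomputable def potential (u φ : ι → ℝ) (x : ι) : ℝ := Real.log (u x) - Real.log (φ x)

/-- Positivity of `u` and of `φ` spreads along edges, so the two crossing numbers vanish together.
The junk value of `log 0` therefore never matters. -/
theorem edge_cases (hu : N.IsGreen s o u) (hφ : N.IsHit s φ) (hs0 : 0 < s) (hs1 : s < 1)
    (x y : ι) :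
    (s * N.c x y * (u x * φ y) = 0 ∧ s * N.c x y * (u y * φ x) = 0) ∨
    (0 < s * N.c x y * (u x * φ y) ∧ 0 < s * N.c x y * (u y * φ x) ∧
      potential u φ x - potential u φ y =
        Real.log (s * N.c x y * (u x * φ y)) - Real.log (s * N.c x y * (u y * φ x))) := by
  by_cases hc : N.c x y = 0
  · left; simp [hc]
  have hc' : N.c y x ≠ 0 := by rwa [N.c_symm]
  have hcp : 0 < N.c x y := lt_of_le_of_ne (N.c_nonneg _ _) (Ne.symm hc)
  rcases (hu.nonneg hs0.le hs1 x).eq_or_lt with hux | hux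
  · rcases (hu.nonneg hs0.le hs1 y).eq_or_lt with huy | huy
    · left; simp [← hux, ← huy]
    · exact absurd hux (hu.pos_of_adj hs0 hs1 huy hc').ne
  have huy := hu.pos_of_adj hs0 hs1 hux hc
  rcases (hφ.nonneg hs0.le hs1 x).eq_or_lt with hpx | hpx
  · rcases (hφ.nonneg hs0.le hs1 y).eq_or_lt with hpy | hpy
    · left; simp [← hpx, ← hpy]
    · exact absurd hpx (hφ.pos_of_adj hs0 hs1 hpy hc').ne
  have hpy := hφ.pos_of_adj hs0 hs1 hpx hc
  right
  refine ⟨by positivity, by positivity, ?_⟩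
  have hk := (mul_pos hs0 hcp).ne'
  rw [Real.log_mul hk (mul_pos hux hpy).ne', Real.log_mul hk (mul_pos huy hpx).ne',
    Real.log_mul hux.ne' hpy.ne', Real.log_mul huy.ne' hpx.ne']
  simp only [potential]
  ring

theorem flow_eq_sub (x y : ι) : N.flow s u φ x y =
    s * N.c x y * (u x * φ y) - s * N.c x y * (u y * φ x) := by
  unfold flow; ring

theorem edge_le (hu : N.IsGreen s o u) (hφ : N.IsHit s φ) (hs0 : 0 < s) (hs1 : s < 1)
    {q : ℝ} (hq : 1 < q) (x y : ι) :
    ((q + 1) / (q - 1) + 2 * q / (q - 1) ^ 2 * Real.log q) * |N.flow s u φ x y|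
      - 2 * q / (q - 1) ^ 2 * (N.flow s u φ x y * (potential u φ x - potential u φ y)) ≤
    s * N.c x y * (u x * φ y) + s * N.c x y * (u y * φ x) := by
  rw [flow_eq_sub]
  rcases edge_cases hu hφ hs0 hs1 x y with ⟨h1, h2⟩ | ⟨h1, h2, h3⟩
  · simp [h1, h2]
  · rw [h3]
    exact tangent_mul_abs_sub_le_add hq h1 h2

theorem flow_mul_potential_ge (hu : N.IsGreen s o u) (hφ : N.IsHit s φ) (hs0 : 0 < s)
    (hs1 : s < 1) {r : ℝ} (hr : 0 < r) (x y : ι) :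
    N.flow s u φ x y * Real.log r + (1 - r⁻¹) * (s * N.c x y * (u x * φ y))
        + (1 - r) * (s * N.c x y * (u y * φ x)) ≤
      N.flow s u φ x y * (potential u φ x - potential u φ y) := by
  rw [flow_eq_sub]
  rcases edge_cases hu hφ hs0 hs1 x y with ⟨h1, h2⟩ | ⟨h1, h2, h3⟩
  · simp [h1, h2]
  · rw [h3]
    exact tangent_le_sub_mul_log_sub hr h1 h2

/-- The drop of the potential from the pole to the target, averaged by the flow. -/
theorem potential_drop_le (hu : N.IsGreen s o u) (hφ : N.IsHit s φ) (hs0 : 0 < s)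
    (hs1 : s < 1) (hpos : 0 < φ o) {κ : ℝ} (hκ : 0 < κ)
    (h : s ^ 2 * (∑ x, N.b x) * u o ≤ κ * φ o ^ 2) :
    potential u φ o * φ o - ∑ x, s * u x * N.b x * potential u φ x ≤ φ o * Real.log κ := by
  have huo := hu.pole_pos hs0.le hs1
  have key : ∀ x, s * u x * N.b x * (potential u φ o - potential u φ x) ≤
      s * u x * N.b x * (Real.log κ - 1) + s ^ 2 * N.b x * u o / (φ o * κ) := by
    intro x
    have hb := N.b_nonneg x
    have hrhs : 0 ≤ s ^ 2 * N.b x * u o / (φ o * κ) := by positivity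
    rcases (hu.nonneg hs0.le hs1 x).eq_or_lt with hux | hux
    · simpa [← hux] using hrhs
    by_cases hbx : N.b x = 0
    · simp [hbx]
    have hpx := hφ.pos_of_b hs0 hs1 hbx
    have hle := hφ.le hs0.le hs1 x
    -- This is Jensen's inequality for `log`, applied through its tangent at 1; the factor `φ x` is
    -- then removed by `φ x ≤ s`.
    have hlog := Real.log_le_sub_one_of_pos (show 0 < u o * φ x / (φ o * u x * κ) by positivity)
    rw [Real.log_div (by positivity) (by positivity), Real.log_mul (by positivity) (by positivity),
      Real.log_mul (by positivity) (by positivity), Real.log_mul (by positivity) (by positivity)]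
      at hlog
    have h1 := mul_le_mul_of_nonneg_left hlog (show 0 ≤ s * u x * N.b x by positivity)
    have h2 : s * u x * N.b x * (u o * φ x / (φ o * u x * κ)) ≤
        s ^ 2 * N.b x * u o / (φ o * κ) := by
      have : s * u x * N.b x * (u o * φ x / (φ o * u x * κ)) =
          φ x * (s * N.b x * u o / (φ o * κ)) := by field_simp
      rw [this]
      calc φ x * (s * N.b x * u o / (φ o * κ)) ≤ s * (s * N.b x * u o / (φ o * κ)) := by gcongr
        _ = _ := by ring
    simp only [potential]
    nlinarith
  have hsum := Finset.sum_le_sum fun x (_ : x ∈ Finset.univ) => key x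
  rw [Finset.sum_add_distrib, ← Finset.sum_mul, ← hu.hit_pole_eq hφ] at hsum
  have e1 : ∑ x, s * u x * N.b x * (potential u φ o - potential u φ x) =
      potential u φ o * φ o - ∑ x, s * u x * N.b x * potential u φ x := by
    simp only [mul_sub, Finset.sum_sub_distrib, ← Finset.sum_mul]
    rw [← hu.hit_pole_eq hφ, mul_comm]
  have e2 : ∑ x, s ^ 2 * N.b x * u o / (φ o * κ) = s ^ 2 * (∑ x, N.b x) * u o / (φ o * κ) := by
    rw [← Finset.sum_div, ← Finset.sum_mul, ← Finset.mul_sum]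
  have e3 : s ^ 2 * (∑ x, N.b x) * u o / (φ o * κ) ≤ φ o := by
    rw [div_le_iff₀ (by positivity)]
    linarith [h]
  rw [e1, e2] at hsum
  linarith

theorem sum_swap (s : ℝ) (u φ : ι → ℝ) :
    ∑ x, ∑ y, s * N.c x y * (u y * φ x) = ∑ x, ∑ y, s * N.c x y * (u x * φ y) := by
  rw [Finset.sum_comm]
  exact Finset.sum_congr rfl fun x _ => Finset.sum_congr rfl fun y _ => by rw [N.c_symm]

/-- `d` is a lower bound for the graph distance from `o`, truncated at `n`. -/
structure IsDist (N : KilledNetwork ι) (o : ι) (n : ℕ) (d : ι → ℝ) : Prop where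
  pole : d o = 0
  nonneg : ∀ x, 0 ≤ d x
  sub_le : ∀ x y, N.c x y ≠ 0 → d x ≤ d y + 1
  target : ∀ x, N.b x ≠ 0 → d x = n

/-- All the flow ends at level `n`. The value `d o` is left free, since the distance is also used
truncated from below at 1. -/
theorem sum_flow_mul_dist (hu : N.IsGreen s o u) (hφ : N.IsHit s φ) {n : ℕ} {d : ι → ℝ}
    (htarget : ∀ x, N.b x ≠ 0 → d x = n) :
    ∑ x, ∑ y, N.flow s u φ x y * (d y - d x) = 2 * (n - d o) * φ o := by
  have h := sum_flow_mul_sub hu hφ d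
  have h1 : ∑ x, s * u x * N.b x * d x = φ o * n := by
    rw [hu.hit_pole_eq hφ, Finset.sum_mul]
    refine Finset.sum_congr rfl fun x _ => ?_
    by_cases hb : N.b x = 0
    · simp [hb]
    · rw [htarget x hb]
  rw [h1] at h
  have h2 : ∑ x, ∑ y, N.flow s u φ x y * (d y - d x) =
      -∑ x, ∑ y, N.flow s u φ x y * (d x - d y) := by
    simp only [← Finset.sum_neg_distrib]
    exact Finset.sum_congr rfl fun x _ => Finset.sum_congr rfl fun y _ => by ring
  rw [h2, h]
  ring

theorem flow_mul_le_abs {d : ι → ℝ} (hd : ∀ x y, N.c x y ≠ 0 → d x ≤ d y + 1) (x y : ι) :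
    N.flow s u φ x y * (d y - d x) ≤ |N.flow s u φ x y| := by
  by_cases hc : N.c x y = 0
  · simp [flow, hc]
  have h1 := hd x y hc
  have h2 := hd y x (by rwa [N.c_symm])
  refine (le_abs_self _).trans ?_
  rw [abs_mul]
  exact mul_le_of_le_one_right (abs_nonneg _) (abs_le.2 ⟨by linarith, by linarith⟩)

theorem slope_nonneg {q : ℝ} (hq : 1 < q) :
    0 ≤ (q + 1) / (q - 1) + 2 * q / (q - 1) ^ 2 * Real.log q := by
  have h1 : 0 < q - 1 := by linarith
  have h2 := Real.log_pos hq
  positivity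

/-- Summing the tangent bound over edges, the distance bounds the absolute flow from below and
`potential_drop_le` bounds the energy term from above. With `κ = q ^ n` the terms in `log q` cancel.
-/
theorem sum_steps_ge_of_drop (hu : N.IsGreen s o u) (hφ : N.IsHit s φ) (hs0 : 0 < s)
    (hs1 : s < 1) (hpos : 0 < φ o) {n : ℕ} {d : ι → ℝ} (hd : N.IsDist o n d) {q : ℝ} (hq : 1 < q)
    (h : s ^ 2 * (∑ x, N.b x) * u o ≤ q ^ n * φ o ^ 2) :
    n * φ o * ((q + 1) / (q - 1)) ≤ ∑ x, ∑ y, s * N.c x y * (u x * φ y) := by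
  have hdrop := potential_drop_le hu hφ hs0 hs1 hpos (by positivity) h
  rw [Real.log_pow] at hdrop
  have hF := sum_flow_mul_sub hu hφ (potential u φ)
  have hD := sum_flow_mul_dist hu hφ hd.target
  rw [hd.pole] at hD
  have hα := slope_nonneg hq
  have hβ : 0 ≤ 2 * q / (q - 1) ^ 2 := by positivity
  set α := (q + 1) / (q - 1) + 2 * q / (q - 1) ^ 2 * Real.log q with hαdef
  set β := 2 * q / (q - 1) ^ 2
  have hsum := Finset.sum_le_sum fun x (_ : x ∈ Finset.univ) =>
    Finset.sum_le_sum fun y (_ : y ∈ Finset.univ) =>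
      (show α * (N.flow s u φ x y * (d y - d x))
          - β * (N.flow s u φ x y * (potential u φ x - potential u φ y)) ≤
        s * N.c x y * (u x * φ y) + s * N.c x y * (u y * φ x) from
      (sub_le_sub_right (mul_le_mul_of_nonneg_left (flow_mul_le_abs hd.sub_le x y) hα) _).trans
        (edge_le hu hφ hs0 hs1 hq x y))
  simp only [Finset.sum_sub_distrib, Finset.sum_add_distrib, ← Finset.mul_sum, sum_swap] at hsum
  rw [hF, hD] at hsum
  have h1 := mul_le_mul_of_nonneg_left hdrop hβ
  have e : (q + 1) / (q - 1) = α - β * Real.log q := by rw [hαdef]; ring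
  rw [e]
  nlinarith

/-- At the pole the total crossings are known: `φ o * R` outward and `φ o * (R - 1)` inward, with `R
= W o * u o`. Only the other edges need the tangent bound, and for them `n - 1` levels remain. -/
theorem sum_steps_ge_of_pole (hu : N.IsGreen s o u) (hφ : N.IsHit s φ) (hs0 : 0 < s)
    (hs1 : s < 1) (hpos : 0 < φ o) {n : ℕ} (hn : 1 ≤ n) {d : ι → ℝ} (hd : N.IsDist o n d)
    {q : ℝ} (hq : 1 < q) {κ : ℝ} (hκ : 0 < κ) (hR : 1 < N.W o * u o)
    (h : s ^ 2 * (∑ x, N.b x) * u o ≤ κ * φ o ^ 2) :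
    φ o * ((n - 1) * ((q + 1) / (q - 1) + 2 * q / (q - 1) ^ 2 * Real.log q)
        - 2 * q / (q - 1) ^ 2 * (Real.log κ - Real.log (N.W o * u o / (N.W o * u o - 1)))
        + N.W o * u o) ≤ ∑ x, ∑ y, s * N.c x y * (u x * φ y) := by
  classical
  have hdrop := potential_drop_le hu hφ hs0 hs1 hpos hκ h
  have hF := sum_flow_mul_sub hu hφ (potential u φ)
  have hn' : (1 : ℝ) ≤ n := by exact_mod_cast hn
  have hbo : N.b o = 0 := by
    by_contra hb
    have := hd.target o hb
    rw [hd.pole] at this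
    linarith
  have hD := sum_flow_mul_dist (d := fun x => max (d x) 1) hu hφ
    (fun x hx => by rw [hd.target x hx, max_eq_left hn'])
  have hd' : ∀ x y, N.c x y ≠ 0 → max (d x) 1 ≤ max (d y) 1 + 1 := fun x y hxy =>
    max_le ((hd.sub_le x y hxy).trans (by gcongr; exact le_max_left _ _))
      (by linarith [le_max_right (d y) 1])
  rw [hd.pole, max_eq_right (zero_le_one' ℝ)] at hD
  have hα := slope_nonneg hq
  have hβ : 0 ≤ 2 * q / (q - 1) ^ 2 := by positivity
  set α := (q + 1) / (q - 1) + 2 * q / (q - 1) ^ 2 * Real.log q with hαdef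
  set β := 2 * q / (q - 1) ^ 2 with hβdef
  set R := N.W o * u o with hRdef
  set t : ι → ι → ℝ := fun x y => s * N.c x y * (u x * φ y) + s * N.c x y * (u y * φ x)
      + β * (N.flow s u φ x y * (potential u φ x - potential u φ y)) with ht
  have hedge : ∀ x y, α * |N.flow s u φ x y| ≤ t x y := fun x y => by
    have := edge_le hu hφ hs0 hs1 hq x y
    simp only [ht]
    linarith
  have htsymm : ∀ x y, t y x = t x y := fun x y => by
    simp only [ht, flow_antisymm x y, N.c_symm y x]
    ring
  have hoy : ∀ y, N.flow s u φ o y * (max (d y) 1 - max (d o) 1) = 0 := fun y => by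
    by_cases hc : N.c o y = 0
    · simp [flow, hc]
    have h1 := hd.sub_le y o (by rwa [N.c_symm])
    rw [hd.pole] at h1 ⊢
    rw [max_eq_right (by linarith), max_eq_right (zero_le_one' ℝ)]
    simp
  -- Pairs that meet the pole keep `t` in full, combined by inclusion–exclusion so that the loop at
  -- the pole is counted once; the truncated distance does not change across them.
  have hpt : ∀ x y, α * (N.flow s u φ x y * (max (d y) 1 - max (d x) 1))
      + ((if x = o then t x y else 0) + (if y = o then t x y else 0)
        - (if x = o then (if y = o then t x y else 0) else 0)) ≤ t x y := fun x y => by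
    by_cases hx : x = o
    · subst hx
      rw [hoy y]
      simp
    by_cases hy : y = o
    · subst hy
      have := hoy x
      rw [flow_antisymm x y] at this
      have h0 : N.flow s u φ x y * (max (d y) 1 - max (d x) 1) = 0 := by linarith
      rw [h0]
      simp [hx]
    simp only [hx, hy, if_false]
    have := (mul_le_mul_of_nonneg_left (flow_mul_le_abs (s := s) (u := u) (φ := φ) hd' x y)
      hα).trans (hedge x y)
    linarith
  have hsum := Finset.sum_le_sum fun x (_ : x ∈ Finset.univ) =>
    Finset.sum_le_sum fun y (_ : y ∈ Finset.univ) => hpt x y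
  have hsplit : ∑ x, ∑ y, ((if x = o then t x y else 0) + (if y = o then t x y else 0)
        - (if x = o then (if y = o then t x y else 0) else 0)) = 2 * ∑ y, t o y - t o o := by
    simp only [Finset.sum_sub_distrib, Finset.sum_add_distrib]
    have e1 : ∑ x, ∑ y, (if x = o then t x y else 0) = ∑ y, t o y := by
      rw [Finset.sum_comm]; simp
    have e2 : ∑ x, ∑ y, (if y = o then t x y else 0) = ∑ y, t o y := by
      simp [htsymm o]
    have e3 : ∑ x, ∑ y, (if x = o then (if y = o then t x y else 0) else 0) = t o o := by
      rw [Finset.sum_comm]; simp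
    rw [e1, e2, e3]
    ring
  have hW := hφ.W_mul o
  have hG := hu.W_mul_self
  have hout : ∑ y, s * N.c o y * (u o * φ y) = φ o * R := by
    have : ∑ y, s * N.c o y * (u o * φ y) = u o * (s * ∑ y, N.c o y * φ y) := by
      simp only [Finset.mul_sum]
      exact Finset.sum_congr rfl fun y _ => by ring
    rw [this, hRdef]
    rw [hbo] at hW
    linear_combination -u o * hW
  have hin : ∑ y, s * N.c o y * (u y * φ o) = φ o * (R - 1) := by
    have : ∑ y, s * N.c o y * (u y * φ o) = φ o * (s * ∑ y, N.c o y * u y) := by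
      simp only [Finset.mul_sum]
      exact Finset.sum_congr rfl fun y _ => by ring
    rw [this]
    linear_combination -φ o * hG
  have hR1 : 0 < R - 1 := by linarith
  -- The tangent plane is taken on the ray through the total outward and inward crossings, as in the
  -- log-sum inequality.
  have hpole : φ o * Real.log (R / (R - 1)) ≤
      ∑ y, N.flow s u φ o y * (potential u φ o - potential u φ y) := by
    have h1 := Finset.sum_le_sum fun y (_ : y ∈ Finset.univ) =>
      flow_mul_potential_ge hu hφ hs0 hs1 (show 0 < R / (R - 1) by positivity) o y
    rw [Finset.sum_add_distrib, Finset.sum_add_distrib, ← Finset.mul_sum, ← Finset.mul_sum,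
      ← Finset.sum_mul, hout, hin, sum_flow hu hφ, hbo, if_pos rfl] at h1
    refine le_trans (le_of_eq ?_) h1
    have hR0 : R ≠ 0 := by positivity
    field_simp
    ring
  have htsum : φ o * (2 * R - 1) + β * (φ o * Real.log (R / (R - 1))) ≤ ∑ y, t o y := by
    simp only [ht, Finset.sum_add_distrib, ← Finset.mul_sum _ _ β]
    rw [hout, hin]
    have := mul_le_mul_of_nonneg_left hpole hβ
    linarith
  have htoo : t o o ≤ 2 * (φ o * (R - 1)) := by
    have h1 : s * N.c o o * (u o * φ o) ≤ φ o * (R - 1) := by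
      rw [← hin]
      exact Finset.single_le_sum (f := fun y => s * N.c o y * (u y * φ o))
        (fun y _ => mul_nonneg (mul_nonneg hs0.le (N.c_nonneg _ _))
          (mul_nonneg (hu.nonneg hs0.le hs1 y) hpos.le)) (Finset.mem_univ o)
    simp only [ht]
    linarith
  have hT : ∑ x, ∑ y, t x y = 2 * ∑ x, ∑ y, s * N.c x y * (u x * φ y)
      + β * ∑ x, ∑ y, N.flow s u φ x y * (potential u φ x - potential u φ y) := by
    simp only [ht, Finset.sum_add_distrib, ← Finset.mul_sum _ _ β, sum_swap]
    ring
  rw [hT, hF] at hsum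
  have hL : ∑ x, ∑ y, (α * (N.flow s u φ x y * (max (d y) 1 - max (d x) 1))
      + ((if x = o then t x y else 0) + (if y = o then t x y else 0)
        - (if x = o then (if y = o then t x y else 0) else 0))) =
      α * (2 * (n - 1) * φ o) + (2 * ∑ y, t o y - t o o) := by
    rw [← hsplit, ← hD]
    simp only [Finset.sum_add_distrib (g := fun y => _ - _), Finset.sum_add_distrib,
      Finset.mul_sum]
  rw [hL] at hsum
  have h1 := mul_le_mul_of_nonneg_left hdrop hβ
  nlinarith

end KilledNetwork

/-- The terms in `R` combine to a multiple of `log (R - 1)`, which is dominated by the linear gain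
`R` through `log y ≤ y - 1` at `y = (R - 1) / β`. -/
theorem mul_add_div_sub_le_of_le {q g R : ℝ} {n : ℕ} (hg : 1 < g) (hgq : g ≤ q) (hR : 1 < R) :
    n * ((q + 1) / (q - 1)) ≤
      (n - 1) * ((q + 1) / (q - 1) + 2 * q / (q - 1) ^ 2 * Real.log q)
        - 2 * q / (q - 1) ^ 2 *
          (Real.log (R * q ^ n * ((g - 1) ^ 2 / (2 * g ^ 2))) - Real.log (R / (R - 1))) + R := by
  have hq1 : 0 < q - 1 := by linarith
  have hq0 : 0 < q := by linarith
  have hg1 : 0 < g - 1 := by linarith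
  have hg0 : 0 < g := by linarith
  have hR1 : 0 < R - 1 := by linarith
  have hR0 : 0 < R := by linarith
  set Y := (g - 1) ^ 2 / (2 * g ^ 2) with hY
  have hY0 : 0 < Y := by positivity
  set β := 2 * q / (q - 1) ^ 2 with hβ
  have hβ0 : 0 < β := by positivity
  have e1 : Real.log (R * q ^ n * Y) - Real.log (R / (R - 1)) =
      (n - 1) * Real.log q + Real.log (q * Y * (R - 1)) := by
    rw [Real.log_mul (by positivity) hY0.ne', Real.log_mul hR0.ne' (by positivity), Real.log_pow,
      Real.log_div hR0.ne' hR1.ne', Real.log_mul (by positivity) hR1.ne',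
      Real.log_mul hq0.ne' hY0.ne']
    ring
  -- The map `x ↦ x / (x - 1)` decreases on `x > 1`, and `g ≤ q`. This is where the square of `g -
  -- 1` in the equation for `g` is used.
  have h1 : β * (q * Y) ≤ 1 := by
    have : β * (q * Y) = (q * (g - 1) / ((q - 1) * g)) ^ 2 := by
      rw [hβ, hY]; field_simp
    rw [this]
    have h2 : q * (g - 1) / ((q - 1) * g) ≤ 1 := by
      rw [div_le_one (by positivity)]
      nlinarith
    exact pow_le_one₀ (by positivity) h2
  have h2 : Real.log (q * Y * (R - 1)) ≤ (R - 1) / β - 1 := by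
    refine (Real.log_le_log (by positivity) ?_).trans
      (Real.log_le_sub_one_of_pos (show 0 < (R - 1) / β by positivity))
    rw [le_div_iff₀ hβ0]
    nlinarith
  have h3 := mul_le_mul_of_nonneg_left h2 hβ0.le
  have h4 : β * ((R - 1) / β - 1) = R - 1 - β := by field_simp
  have h5 : (q + 1) / (q - 1) ≤ 1 + β := by
    have : 1 + β - (q + 1) / (q - 1) = 2 / (q - 1) ^ 2 := by
      rw [hβ]; field_simp; ring
    have : 0 ≤ 2 / (q - 1) ^ 2 := by positivity
    linarith
  rw [e1]
  rw [h4] at h3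
  nlinarith

/-! ### From the number of steps to the comparison of discounts -/

namespace KilledNetwork

variable {ι : Type*} [Fintype ι] {N : KilledNetwork ι} {s : ℝ} {o : ι} {u φ : ι → ℝ}

/-- Each weighted visit is followed by a step to an interior vertex or by the final step into the
target. -/
theorem IsHit.sum_W_mul (hφ : N.IsHit s φ) (hu : N.IsGreen s o u) :
    ∑ x, N.W x * u x * φ x = ∑ x, ∑ y, s * N.c x y * (u x * φ y) + φ o := by
  rw [hu.hit_pole_eq hφ, ← Finset.sum_add_distrib]
  refine Finset.sum_congr rfl fun x _ => ?_
  have h : ∑ y, s * N.c x y * (u x * φ y) = u x * (s * ∑ y, N.c x y * φ y) := by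
    simp only [Finset.mul_sum]
    exact Finset.sum_congr rfl fun y _ => by ring
  rw [h]
  linear_combination u x * hφ.W_mul x

theorem IsDist.b_pole {n : ℕ} {d : ι → ℝ} (hd : N.IsDist o n d) (hn : n ≠ 0) : N.b o = 0 := by
  by_contra hb
  have := hd.target o hb
  rw [hd.pole] at this
  exact hn (by exact_mod_cast this.symm)

/-- The target is not adjacent to the pole, so at least two steps are needed. This forces `m < 1`.
-/
theorem IsHit.pole_le_sq (hφ : N.IsHit s φ) (hs0 : 0 < s) (hs1 : s < 1) (hb : N.b o = 0) :
    φ o ≤ s ^ 2 := by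
  have h := hφ.W_mul o
  have h1 : ∑ y, N.c o y * φ y ≤ N.W o * s := by
    refine le_trans ?_ (mul_le_mul_of_nonneg_right (N.sum_c_le o) hs0.le)
    rw [Finset.sum_mul]
    exact Finset.sum_le_sum fun y _ =>
      mul_le_mul_of_nonneg_left (hφ.le hs0.le hs1 y) (N.c_nonneg _ _)
  have h2 := mul_le_mul_of_nonneg_left h1 hs0.le
  refine le_of_mul_le_mul_left ?_ (N.W_pos o)
  rw [h, hb]
  linarith

/-- If the target can be reached, the walk can return to the pole from a neighbour, so the expected
number of visits exceeds one. -/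
theorem IsGreen.one_lt (hu : N.IsGreen s o u) (hφ : N.IsHit s φ) (hs0 : 0 < s) (hs1 : s < 1)
    (hb : N.b o = 0) (hpos : 0 < φ o) : 1 < N.W o * u o := by
  have h := hφ.W_mul o
  have h1 : ∑ y, N.c o y * φ y ≠ 0 := by
    intro h0
    rw [h0, hb] at h
    have := mul_pos (N.W_pos o) hpos
    linarith
  obtain ⟨y, -, hy⟩ := Finset.exists_ne_zero_of_sum_ne_zero h1
  have hc : N.c o y ≠ 0 := left_ne_zero_of_mul hy
  have huy := hu.pos_of_adj hs0 hs1 (hu.pole_pos hs0.le hs1) hc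
  have hcp : 0 < N.c o y := lt_of_le_of_ne (N.c_nonneg _ _) hc.symm
  have h2 : N.c o y * u y ≤ ∑ z, N.c o z * u z :=
    Finset.single_le_sum (f := fun z => N.c o z * u z)
      (fun z _ => mul_nonneg (N.c_nonneg _ _) (hu.nonneg hs0.le hs1 z)) (Finset.mem_univ y)
  have h3 := mul_pos hs0 ((mul_pos hcp huy).trans_le h2)
  rw [hu.W_mul_self]
  linarith

/-- The lower bound on the expected number of steps of the walk conditioned to hit the target that
makes the comparison with bias `g` work at each discount `s`, where `m` is the geometric mean of
the discounts of `n` stages on the way to the target. -/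
def StepBound (N : KilledNetwork ι) (o : ι) (n : ℕ) (g : ℝ) : Prop :=
  ∀ ⦃s : ℝ⦄ ⦃u φ : ι → ℝ⦄ ⦃m : ℝ⦄, 0 < s → s < 1 → N.IsGreen s o u → N.IsHit s φ →
    0 < m → m < 1 → φ o = s * m ^ n → m ≤ g ∧
      n * φ o * ((g + m ^ 2) / (g - m ^ 2)) ≤ ∑ x, ∑ y, s * N.c x y * (u x * φ y)

theorem add_div_sub_eq {g m : ℝ} (hm : m ≠ 0) :
    (g / m ^ 2 + 1) / (g / m ^ 2 - 1) = (g + m ^ 2) / (g - m ^ 2) := by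
  have h1 : g / m ^ 2 + 1 = (g + m ^ 2) / m ^ 2 := by field_simp
  have h2 : g / m ^ 2 - 1 = (g - m ^ 2) / m ^ 2 := by field_simp
  rw [h1, h2, div_div_div_cancel_right₀ (by positivity)]

/-- For `q = g / m ^ 2` one has `q ^ n * φ o ^ 2 = s ^ 2 * g ^ n`, so the hypothesis is the one
needed for the drop. The bound `m ≤ g` follows from `u ≤ u o` in the decomposition of `φ o`. -/
theorem stepBound_of_resistance {n : ℕ} (hn : n ≠ 0) {d : ι → ℝ} (hd : N.IsDist o n d) {g : ℝ}
    (hg : 0 ≤ g)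
    (h : ∀ s u, 0 < s → s < 1 → N.IsGreen s o u → (∑ x, N.b x) * u o ≤ g ^ n) :
    N.StepBound o n g := by
  intro s u φ m hs0 hs1 hu hφ hm0 hm1 hm
  have hZ := h s u hs0 hs1 hu
  have hmg : m ≤ g := by
    refine le_of_pow_le_pow_left₀ hn hg (le_trans ?_ hZ)
    refine le_of_mul_le_mul_left ?_ hs0
    rw [← hm, hu.hit_pole_eq hφ, Finset.sum_mul, Finset.mul_sum]
    refine Finset.sum_le_sum fun x _ => ?_
    have := mul_le_mul_of_nonneg_left (hu.le_pole hs0.le hs1 x)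
      (mul_nonneg hs0.le (N.b_nonneg x))
    linarith
  refine ⟨hmg, ?_⟩
  have hg0 : 0 < g := hm0.trans_le hmg
  have hq : 1 < g / m ^ 2 := by
    rw [one_lt_div (by positivity)]
    nlinarith
  have hpos : 0 < φ o := by rw [hm]; positivity
  rw [← add_div_sub_eq hm0.ne']
  refine sum_steps_ge_of_drop hu hφ hs0 hs1 hpos hd hq ?_
  have e : (g / m ^ 2) ^ n * φ o ^ 2 = s ^ 2 * g ^ n := by
    rw [hm, div_pow, mul_pow, ← pow_mul, ← pow_mul, mul_comm n 2]
    field_simp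
  rw [e, mul_assoc]
  gcongr

/-- Here `κ` carries the factor `R = W o * u o`, so the unknown `u o` cancels from the hypothesis on
the drop. -/
theorem stepBound_of_weight {n : ℕ} (hn : n ≠ 0) {d : ι → ℝ} (hd : N.IsDist o n d) {g : ℝ}
    (hg : 1 < g) (h : (∑ x, N.b x) * (2 * g ^ 2) ≤ N.W o * ((g - 1) ^ 2 * g ^ n)) :
    N.StepBound o n g := by
  intro s u φ m hs0 hs1 hu hφ hm0 hm1 hm
  refine ⟨by linarith, ?_⟩
  have hg0 : 0 < g := by linarith
  have hgq : g ≤ g / m ^ 2 := by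
    rw [le_div_iff₀ (by positivity)]
    nlinarith [pow_le_one₀ (n := 2) hm0.le hm1.le]
  have hpos : 0 < φ o := by rw [hm]; positivity
  have hR := hu.one_lt hφ hs0 hs1 (hd.b_pole hn) hpos
  have hg1 : 0 < g - 1 := by linarith
  have hu0 := hu.pole_pos hs0.le hs1
  have hW := N.W_pos o
  rw [← add_div_sub_eq hm0.ne', mul_comm (n : ℝ), mul_assoc]
  refine le_trans (mul_le_mul_of_nonneg_left (mul_add_div_sub_le_of_le hg hgq hR) hpos.le)
    (sum_steps_ge_of_pole hu hφ hs0 hs1 hpos (Nat.one_le_iff_ne_zero.2 hn) hd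
      (hg.trans_le hgq) (by positivity) hR ?_)
  have e : N.W o * u o * (g / m ^ 2) ^ n * ((g - 1) ^ 2 / (2 * g ^ 2)) * φ o ^ 2 =
      s ^ 2 * (N.W o * ((g - 1) ^ 2 * g ^ n) / (2 * g ^ 2)) * u o := by
    rw [hm, div_pow, mul_pow, ← pow_mul, ← pow_mul, mul_comm n 2]
    field_simp
  rw [e]
  gcongr
  rwa [le_div_iff₀ (by positivity)]

theorem exists_mean_step {n : ℕ} (hn : n ≠ 0) {d : ι → ℝ} (hd : N.IsDist o n d) {g : ℝ}
    (hstep : N.StepBound o n g) (hs0 : 0 < s) (hs1 : s < 1) (hφs : N.IsHit s φ)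
    (hpos : 0 < φ o) :
    ∃ m, 0 < m ∧ m < 1 ∧ φ o = s * m ^ n ∧ (g + 1) * m ≤ s * (g + m ^ 2) := by
  have hn' : (n : ℝ) ≠ 0 := by exact_mod_cast hn
  have hexφ : ∀ t : ℝ, ∃ f, 0 < t → t < 1 → N.IsHit t f := fun t => by
    by_cases ht : 0 < t ∧ t < 1
    · obtain ⟨f, hf⟩ := N.exists_op_eq ht.1.le ht.2 fun x => t * N.b x
      exact ⟨f, fun _ _ x => congrFun hf x⟩
    · exact ⟨0, fun h1 h2 => absurd ⟨h1, h2⟩ ht⟩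
  have hexu : ∀ t : ℝ, ∃ f, 0 < t → t < 1 → N.IsGreen t o f := fun t => by
    by_cases ht : 0 < t ∧ t < 1
    · obtain ⟨f, hf⟩ := N.exists_op_eq ht.1.le ht.2
        (open Classical in fun x => if x = o then 1 else 0)
      exact ⟨f, fun _ _ x => congrFun hf x⟩
    · exact ⟨0, fun h1 h2 => absurd ⟨h1, h2⟩ ht⟩
  choose Φ hΦ using hexφ
  choose U hU using hexu
  have hΦs : Φ s o = φ o := by
    have := (hU s hs0 hs1).hit_sub (hΦ s hs0 hs1) hφs hs0.ne'
    rw [div_self hs0.ne'] at this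
    linarith
  have hΦpos : ∀ t, s ≤ t → t < 1 → 0 < Φ t o := fun t hst ht1 => by
    have ht0 := hs0.trans_le hst
    have h := (hU s hs0 hs1).hit_sub hφs (hΦ t ht0 ht1) ht0.ne'
    have h1 : 0 ≤ 1 - s / t := by
      rw [sub_nonneg]; exact div_le_one_of_le₀ hst ht0.le
    have h2 : 0 ≤ ∑ x, N.W x * U s x * Φ t x := Finset.sum_nonneg fun x _ =>
      mul_nonneg (mul_nonneg (N.W_pos x).le ((hU s hs0 hs1).nonneg hs0.le hs1 x))
        ((hΦ t ht0 ht1).nonneg ht0.le ht1 x)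
    have := mul_nonneg h1 h2
    linarith
  set m : ℝ → ℝ := fun t => Real.exp ((Real.log (Φ t o) - Real.log t) / n) with hm
  have hm0 : ∀ t, 0 < m t := fun t => Real.exp_pos _
  have hmpow : ∀ t, s ≤ t → t < 1 → Φ t o = t * m t ^ n := fun t hst ht1 => by
    have ht0 := hs0.trans_le hst
    have h1 := hΦpos t hst ht1
    rw [hm, ← Real.exp_nat_mul, mul_div_cancel₀ _ hn', Real.exp_sub, Real.exp_log h1,
      Real.exp_log ht0]
    field_simp
  have hm1 : ∀ t, s ≤ t → t < 1 → m t < 1 := fun t hst ht1 => by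
    have ht0 := hs0.trans_le hst
    have h1 := (hΦ t ht0 ht1).pole_le_sq ht0 ht1 (hd.b_pole hn)
    rw [hmpow t hst ht1] at h1
    by_contra! hge
    have := one_le_pow₀ hge (n := n)
    nlinarith
  have hstep' : ∀ t (hst : s ≤ t) (ht1 : t < 1), _ := fun t hst ht1 =>
    hstep (hs0.trans_le hst) ht1 (hU t (hs0.trans_le hst) ht1) (hΦ t (hs0.trans_le hst) ht1)
      (hm0 t) (hm1 t hst ht1) (hmpow t hst ht1)
  set H : ℝ → ℝ := fun t => t * (g / m t + m t) with hH
  have hderiv : ∀ t, s ≤ t → t < 1 → ∃ H', HasDerivAt H H' t ∧ H' ≤ 0 := fun t hst ht1 => by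
    have ht0 := hs0.trans_le hst
    have hψ := hΦpos t hst ht1
    obtain ⟨hmg, hS⟩ := hstep' t hst ht1
    have hmt := hm0 t
    have hgm : 0 < g - m t ^ 2 := by nlinarith [hm1 t hst ht1]
    have dψ := N.hasDerivAt_hit hΦ ht0 ht1 (hU t ht0 ht1)
    rw [(hΦ t ht0 ht1).sum_W_mul (hU t ht0 ht1)] at dψ
    set S := ∑ x, ∑ y, t * N.c x y * (U t x * Φ t y)
    -- Subtracting `t⁻¹` removes the final step from the mean hitting time, so that only `S`
    -- remains.
    have dm : HasDerivAt m (m t * (S / (n * t * Φ t o))) t := by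
      have h1 : HasDerivAt m (m t * (((S + Φ t o) / t / Φ t o - t⁻¹) / n)) t :=
        (((dψ.log hψ.ne').sub (Real.hasDerivAt_log ht0.ne')).div_const (n : ℝ)).exp
      convert h1 using 2
      field_simp
      ring
    have dH := (hasDerivAt_id t).mul (((hasDerivAt_const t g).div dm hmt.ne').add dm)
    refine ⟨_, dH, ?_⟩
    have hS' : (g + m t ^ 2) / (g - m t ^ 2) ≤ S / (n * Φ t o) := by
      rw [le_div_iff₀ (by positivity)]
      linarith
    rw [div_le_iff₀ hgm] at hS'
    have e : 1 * (g / m t + m t) + t * ((0 * m t - g * (m t * (S / (n * t * Φ t o)))) / m t ^ 2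
        + m t * (S / (n * t * Φ t o))) =
        ((g + m t ^ 2) - S / (n * Φ t o) * (g - m t ^ 2)) / m t := by
      field_simp
      ring
    refine le_of_eq_of_le e ?_
    exact div_nonpos_of_nonpos_of_nonneg (by linarith) hmt.le
  have hanti : AntitoneOn H (Set.Ico s 1) := by
    refine antitoneOn_of_deriv_nonpos (convex_Ico s 1) ?_ ?_ ?_
    · intro t ht
      obtain ⟨H', h1, -⟩ := hderiv t ht.1 ht.2
      exact h1.continuousAt.continuousWithinAt
    · intro t ht
      rw [interior_Ico] at ht
      obtain ⟨H', h1, -⟩ := hderiv t ht.1.le ht.2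
      exact h1.differentiableAt.differentiableWithinAt
    · intro t ht
      rw [interior_Ico] at ht
      obtain ⟨H', h1, h2⟩ := hderiv t ht.1.le ht.2
      rwa [h1.deriv]
  have hHge : ∀ t, s ≤ t → t < 1 → t * (g + 1) ≤ H t := fun t hst ht1 => by
    have ht0 := hs0.trans_le hst
    have hmg := (hstep' t hst ht1).1
    have hmt := hm0 t
    -- Both `m < 1` and `m ≤ g` enter here: `x ↦ g / x + x` takes the value `g + 1` at 1 and at `g`.
    have h1 : 0 ≤ (1 - m t) * (g - m t) / m t :=
      div_nonneg (mul_nonneg (by linarith [hm1 t hst ht1]) (by linarith)) hmt.le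
    have e : g / m t + m t = g + 1 + (1 - m t) * (g - m t) / m t := by
      field_simp; ring
    simp only [hH]
    rw [e]
    nlinarith [mul_nonneg ht0.le h1]
  have hHs : g + 1 ≤ H s := by
    have hlim : Filter.Tendsto (fun t : ℝ => t * (g + 1)) (nhdsWithin 1 (Set.Iio 1))
        (nhds (1 * (g + 1))) :=
      (Filter.tendsto_id.mul_const _).mono_left nhdsWithin_le_nhds
    rw [one_mul] at hlim
    refine le_of_tendsto hlim ?_
    filter_upwards [Ioo_mem_nhdsLT hs1] with t ht
    exact (hHge t ht.1.le ht.2).trans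
      (hanti (Set.left_mem_Ico.2 hs1) ⟨ht.1.le, ht.2⟩ ht.1.le)
  refine ⟨m s, hm0 s, hm1 s le_rfl hs1, ?_, ?_⟩
  · rw [← hΦs]; exact hmpow s le_rfl hs1
  · have hms := hm0 s
    have := mul_le_mul_of_nonneg_right hHs hms.le
    refine this.trans (le_of_eq ?_)
    simp only [hH]
    field_simp

end KilledNetwork

/-! ### Laplace transforms as limits of truncated hitting recursions -/

noncomputable section

/-- The discounted probability to hit `A` within `k` steps from `x`, for the chain with transition
probabilities `K`. -/
def discHit {V : Type*} (K : V → V → ℝ≥0∞) (A : Set V) (s : ℝ≥0∞) : ℕ → V → ℝ≥0∞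
  | 0, x => open Classical in if x ∈ A then 1 else 0
  | k + 1, x => open Classical in if x ∈ A then 1 else s * ∑' y, K x y * discHit K A s k y

/-- The discount `s ^ T`, where `T` is the time that the path needs from time `j` on to hit `A`,
and `0` if `T > k`. -/
def pathHit {V Ω : Type*} (X : ℕ → Ω → V) (A : Set V) (s : ℝ≥0∞) : ℕ → ℕ → Ω → ℝ≥0∞
  | 0, j, ω => open Classical in if X j ω ∈ A then 1 else 0
  | k + 1, j, ω => open Classical in if X j ω ∈ A then 1 else s * pathHit X A s k (j + 1) ω

section Path

variable {V Ω : Type*} {X : ℕ → Ω → V} {A : Set V} {s : ℝ≥0∞} {ω : Ω}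

theorem pathHit_le_succ (k j : ℕ) : pathHit X A s k j ω ≤ pathHit X A s (k + 1) j ω := by
  induction k generalizing j with
  | zero =>
    simp only [pathHit]
    split_ifs <;> simp
  | succ k ih =>
    rw [pathHit, pathHit]
    split_ifs
    · rfl
    · gcongr
      exact ih _

theorem pathHit_eq_zero (k j : ℕ) (h : ∀ i, j ≤ i → i ≤ j + k → X i ω ∉ A) :
    pathHit X A s k j ω = 0 := by
  induction k generalizing j with
  | zero => simp [pathHit, h j le_rfl le_rfl]
  | succ k ih =>
    rw [pathHit, if_neg (h j le_rfl (by omega)),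
      ih (j + 1) fun i hi hi' => h i (by omega) (by omega), mul_zero]

theorem pathHit_eq_pow (t k j : ℕ) (htk : t ≤ k) (ht : X (j + t) ω ∈ A)
    (h : ∀ i, j ≤ i → i < j + t → X i ω ∉ A) : pathHit X A s k j ω = s ^ t := by
  induction t generalizing k j with
  | zero =>
    rw [add_zero] at ht
    cases k <;> simp [pathHit, ht]
  | succ t ih =>
    obtain ⟨k, rfl⟩ : ∃ k', k = k' + 1 := ⟨k - 1, by omega⟩
    rw [pathHit, if_neg (h j le_rfl (by omega)),
      ih k (j + 1) (by omega) (by rwa [add_assoc, add_comm 1 t])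
        (fun i hi hi' => h i (by omega) (by omega)), pow_succ']

theorem hittingTime_eq_top (h : ∀ k, X k ω ∉ A) : hittingTime X A ω = ⊤ := by
  simp [hittingTime, h]

theorem hittingTime_eq_coe {t : ℕ} (ht : X t ω ∈ A) (h : ∀ i < t, X i ω ∉ A) :
    hittingTime X A ω = t := by
  refine le_antisymm (iInf₂_le t ht) (le_iInf₂ fun k hk => ?_)
  by_contra! hlt
  exact h k (by exact_mod_cast hlt) hk

theorem iSup_pathHit (l : ℝ) :
    ⨆ k, pathHit X A (ENNReal.ofReal (Real.exp (-l))) k 0 ω =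
      ENNReal.ofReal (expNeg l (hittingTime X A ω)) := by
  classical
  by_cases hex : ∃ k, X k ω ∈ A
  · set t := Nat.find hex
    have ht : X t ω ∈ A := Nat.find_spec hex
    have hlt : ∀ i < t, X i ω ∉ A := fun i hi => Nat.find_min hex hi
    have hval : ENNReal.ofReal (expNeg l (hittingTime X A ω)) =
        ENNReal.ofReal (Real.exp (-l)) ^ t := by
      rw [hittingTime_eq_coe ht hlt, expNeg, if_neg (ENat.natCast_ne_top t), ENat.toNat_natCast,
        ← ENNReal.ofReal_pow (Real.exp_pos _).le, ← Real.exp_nat_mul, mul_comm]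
    rw [hval]
    refine le_antisymm (iSup_le fun k => ?_) ?_
    · by_cases hk : t ≤ k
      · exact (pathHit_eq_pow t k 0 hk (by rwa [zero_add]) fun i _ hi =>
          hlt i (by omega)).le
      · rw [pathHit_eq_zero k 0 fun i _ hi => hlt i (by omega)]
        exact zero_le
    · refine le_iSup_of_le t (le_of_eq ?_)
      exact (pathHit_eq_pow t t 0 le_rfl (by rwa [zero_add]) fun i _ hi => hlt i (by omega)).symm
  · push Not at hex
    rw [hittingTime_eq_top hex]
    simp [expNeg, pathHit_eq_zero _ 0 fun i _ _ => hex i]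

end Path

theorem expNeg_nonneg (l : ℝ) (t : ℕ∞) : 0 ≤ expNeg l t := by
  unfold expNeg
  split_ifs
  · rfl
  · exact (Real.exp_pos _).le

theorem expNeg_le_one {l : ℝ} (hl : 0 ≤ l) (t : ℕ∞) : expNeg l t ≤ 1 := by
  unfold expNeg
  split_ifs
  · exact zero_le_one
  · rw [Real.exp_le_one_iff]
    nlinarith [mul_nonneg hl (Nat.cast_nonneg (α := ℝ) t.toNat)]

theorem expNeg_add_one (l : ℝ) (t : ℕ∞) : expNeg l (t + 1) = Real.exp (-l) * expNeg l t := by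
  induction t using ENat.recTopCoe with
  | top => simp [expNeg]
  | coe t =>
    have h : ((t : ℕ∞) + 1) = ((t + 1 : ℕ) : ℕ∞) := by push_cast; rfl
    rw [h]
    simp only [expNeg, ENat.natCast_ne_top, if_false, ENat.toNat_natCast]
    rw [← Real.exp_add]
    push_cast
    ring_nf

theorem tendsto_expNeg (t : ℕ∞) :
    Filter.Tendsto (fun l => expNeg l t) (nhdsWithin 0 (Set.Ioi 0)) (nhds (expNeg 0 t)) := by
  refine Filter.Tendsto.mono_left ?_ nhdsWithin_le_nhds
  unfold expNeg
  split_ifs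
  · exact tendsto_const_nhds
  · have : Continuous fun l : ℝ => Real.exp (-l * (t.toNat : ℝ)) := by fun_prop
    exact this.tendsto 0

section Chain

variable {V Ω : Type*} [MeasurableSpace Ω] {P : Measure Ω} {K : V → V → ℝ≥0∞} {o : V}
  {X : ℕ → Ω → V}

theorem IsMarkovChain.measurable_pathHit (hX : IsMarkovChain P K o X) (A : Set V) (s : ℝ≥0∞)
    (k j : ℕ) : Measurable (pathHit X A s k j) := by
  classical
  have hA : ∀ j, MeasurableSet {ω | X j ω ∈ A} := fun j =>
    hX.measurable j (MeasurableSpace.measurableSet_top (s := A))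
  induction k generalizing j with
  | zero => exact Measurable.ite (hA j) measurable_const measurable_const
  | succ k ih => exact Measurable.ite (hA j) measurable_const ((ih (j + 1)).const_mul s)

theorem IsMarkovChain.measurableSet_path (hX : IsMarkovChain P K o X) (k : ℕ) (x : ℕ → V) :
    MeasurableSet {ω | ∀ i ≤ k, X i ω = x i} := by
  have : {ω | ∀ i ≤ k, X i ω = x i} = ⋂ i ∈ {i | i ≤ k}, X i ⁻¹' {x i} := by
    ext ω; simp
  rw [this]
  exact MeasurableSet.biInter (Set.to_countable _) fun i _ =>
    hX.measurable i MeasurableSpace.measurableSet_top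

theorem IsMarkovChain.measurable_expNeg (hX : IsMarkovChain P K o X) (A : Set V) (l : ℝ) :
    Measurable fun ω => expNeg l (hittingTime X A ω) := by
  have h : (fun ω => expNeg l (hittingTime X A ω)) =
      fun ω => (⨆ k, pathHit X A (ENNReal.ofReal (Real.exp (-l))) k 0 ω).toReal := by
    funext ω
    rw [iSup_pathHit, ENNReal.toReal_ofReal (expNeg_nonneg _ _)]
  rw [h]
  exact (Measurable.iSup fun k => hX.measurable_pathHit A _ k 0).ennreal_toReal

/-- The paths of length `j` that have positive probability end where `K` is stochastic. -/
def IsStochasticAlong (P : Measure Ω) (K : V → V → ℝ≥0∞) (X : ℕ → Ω → V) : Prop :=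
  ∀ (j : ℕ) (x : ℕ → V), P {ω | ∀ i ≤ j, X i ω = x i} ≠ 0 → ∑' y, K (x j) y = 1

/-- The Markov property on cylinder sets. The state space may be uncountable, but the support of a
stochastic row is countable, and the one-step extensions along it exhaust the cylinder up to a null
set. -/
theorem IsMarkovChain.setLIntegral_pathHit [IsFiniteMeasure P] (hX : IsMarkovChain P K o X)
    (hK : IsStochasticAlong P K X) (A : Set V) (s : ℝ≥0∞) (k j : ℕ) (x : ℕ → V) :
    ∫⁻ ω in {ω | ∀ i ≤ j, X i ω = x i}, pathHit X A s k j ω ∂P =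
      P {ω | ∀ i ≤ j, X i ω = x i} * discHit K A s k (x j) := by
  classical
  have hconst : ∀ (f : Ω → ℝ≥0∞) (c : ℝ≥0∞), (∀ ω, X j ω = x j → f ω = c) →
      ∫⁻ ω in {ω | ∀ i ≤ j, X i ω = x i}, f ω ∂P = P {ω | ∀ i ≤ j, X i ω = x i} * c := by
    intro f c hf
    rw [setLIntegral_congr_fun (hX.measurableSet_path j x) (g := fun _ => c)
      fun ω hω => hf ω (hω j le_rfl), setLIntegral_const, mul_comm]
  induction k generalizing j x with
  | zero => exact hconst _ _ fun ω hω => by simp [pathHit, discHit, hω]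
  | succ k ih =>
    by_cases hxA : x j ∈ A
    · exact hconst _ _ fun ω hω => by simp [pathHit, discHit, hω, hxA]
    set C := {ω | ∀ i ≤ j, X i ω = x i} with hC
    by_cases hP : P C = 0
    · rw [hP, zero_mul]
      exact setLIntegral_measure_zero _ _ hP
    have hsum := hK j x hP
    set D : V → Set Ω := fun y => {ω | ∀ i ≤ j + 1, X i ω = Function.update x (j + 1) y i}
      with hD
    have hDmeas : ∀ y, MeasurableSet (D y) := fun y => hX.measurableSet_path _ _
    have hDP : ∀ y, P (D y) = P C * K (x j) y := fun y => by
      have h := hX.step j (Function.update x (j + 1) y)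
      rw [Function.update_self, Function.update_of_ne (by omega)] at h
      rw [hD, h]
      congr 2
      ext ω
      refine forall_congr' fun i => imp_congr_right fun hi => ?_
      rw [Function.update_of_ne (by omega)]
    have hDsub : ∀ y, D y ⊆ C := fun y ω hω i hi => by
      have := hω i (by omega)
      rwa [Function.update_of_ne (by omega)] at this
    set S := Function.support (K (x j))
    have hS : S.Countable := Summable.countable_support_ennreal (by rw [hsum]; simp)
    have : Countable S := hS.to_subtype
    have hdisj : Pairwise (Function.onFun Disjoint fun y : S => D y) := by
      intro y y' hne
      refine Set.disjoint_left.2 fun ω h h' => hne (Subtype.ext ?_)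
      have h1 := h (j + 1) le_rfl
      have h2 := h' (j + 1) le_rfl
      rw [Function.update_self] at h1 h2
      rw [← h1, ← h2]
    have hU : P (⋃ y : S, D y) = P C := by
      rw [measure_iUnion hdisj fun y => hDmeas y]
      simp only [hDP]
      rw [ENNReal.tsum_mul_left, tsum_subtype_support, hsum, mul_one]
    have hae : (⋃ y : S, D y : Set Ω) =ᵐ[P] C :=
      ae_eq_of_subset_of_measure_ge (Set.iUnion_subset fun y => hDsub y) hU.ge
        (MeasurableSet.iUnion fun y : S => hDmeas y).nullMeasurableSet (measure_ne_top _ _)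
    have h1 : ∫⁻ ω in C, pathHit X A s (k + 1) j ω ∂P =
        ∫⁻ ω in C, s * pathHit X A s k (j + 1) ω ∂P :=
      setLIntegral_congr_fun (hX.measurableSet_path j x) fun ω hω => by
        have : X j ω ∉ A := by rw [hω j le_rfl]; exact hxA
        simp [pathHit, this]
    rw [h1, lintegral_const_mul _ (hX.measurable_pathHit A s k (j + 1)), ← setLIntegral_congr hae,
      lintegral_iUnion (fun y : S => hDmeas y) hdisj, discHit, if_neg hxA]
    have h2 : ∀ y : S, ∫⁻ ω in D y, pathHit X A s k (j + 1) ω ∂P =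
        P C * (K (x j) y * discHit K A s k y) := fun y => by
      rw [hD]
      simp only
      rw [ih (j + 1) (Function.update x (j + 1) y) fun f c hf => ?_, Function.update_self]
      · rw [← mul_assoc, ← hDP y]
      · rw [setLIntegral_congr_fun (hX.measurableSet_path (j + 1) _) (g := fun _ => c)
          fun ω hω => hf ω (hω (j + 1) le_rfl), setLIntegral_const, mul_comm]
    simp only [h2]
    rw [ENNReal.tsum_mul_left, tsum_subtype_eq_of_support_subset
      (f := fun y => K (x j) y * discHit K A s k y)]
    · ring
    · intro y hy
      exact left_ne_zero_of_mul hy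

theorem IsMarkovChain.lintegral_pathHit [IsProbabilityMeasure P] (hX : IsMarkovChain P K o X)
    (hK : IsStochasticAlong P K X) (A : Set V) (s : ℝ≥0∞) (k : ℕ) :
    ∫⁻ ω, pathHit X A s k 0 ω ∂P = discHit K A s k o := by
  have h := hX.setLIntegral_pathHit hK A s k 0 fun _ => o
  have hae : {ω | ∀ i ≤ 0, X i ω = o} =ᵐ[P] Set.univ := by
    rw [Filter.eventuallyEq_univ]
    filter_upwards [hX.start] with ω hω i hi
    obtain rfl : i = 0 := by omega
    exact hω
  rwa [setLIntegral_congr hae, Measure.restrict_univ, measure_congr hae, measure_univ,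
    one_mul] at h

theorem IsMarkovChain.ofReal_laplace [IsProbabilityMeasure P] (hX : IsMarkovChain P K o X)
    (hK : IsStochasticAlong P K X) (A : Set V) {l : ℝ} (hl : 0 ≤ l) :
    ENNReal.ofReal (laplace P (hittingTime X A) l) =
      ⨆ k, discHit K A (ENNReal.ofReal (Real.exp (-l))) k o := by
  have hint : Integrable (fun ω => expNeg l (hittingTime X A ω)) P :=
    Integrable.of_bound (hX.measurable_expNeg A l).aestronglyMeasurable 1 <|
      Filter.Eventually.of_forall fun ω => by
        rw [Real.norm_of_nonneg (expNeg_nonneg _ _)]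
        exact expNeg_le_one hl _
  rw [laplace, ofReal_integral_eq_lintegral_ofReal hint
    (Filter.Eventually.of_forall fun ω => expNeg_nonneg _ _)]
  simp only [← iSup_pathHit]
  rw [lintegral_iSup (fun k => hX.measurable_pathHit A _ k 0)
    (monotone_nat_of_le_succ fun k ω => pathHit_le_succ k 0)]
  simp only [hX.lintegral_pathHit hK]

theorem IsMarkovChain.tendsto_laplace [IsProbabilityMeasure P] (hX : IsMarkovChain P K o X)
    (A : Set V) :
    Filter.Tendsto (laplace P (hittingTime X A)) (nhdsWithin 0 (Set.Ioi 0))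
      (nhds (laplace P (hittingTime X A) 0)) := by
  refine tendsto_integral_filter_of_dominated_convergence (fun _ => 1) ?_ ?_
    (integrable_const 1) (Filter.Eventually.of_forall fun ω => tendsto_expNeg _)
  · exact Filter.Eventually.of_forall fun l => (hX.measurable_expNeg A l).aestronglyMeasurable
  · filter_upwards [self_mem_nhdsWithin] with l hl
    refine Filter.Eventually.of_forall fun ω => ?_
    rw [Real.norm_of_nonneg (expNeg_nonneg _ _)]
    exact expNeg_le_one (le_of_lt hl) _

theorem laplace_add_one (T : Ω → ℕ∞) (l : ℝ) :
    laplace P (fun ω => T ω + 1) l = Real.exp (-l) * laplace P T l := by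
  simp only [laplace, expNeg_add_one, integral_const_mul]

end Chain

/-! ### The biased walk -/

section Biased

variable {g : ℝ}

theorem tsum_biasedTransition_mul (i : ℤ) (f : ℤ → ℝ≥0∞) :
    ∑' j, biasedTransition g i j * f j =
      ENNReal.ofReal (g / (g + 1)) * f (i + 1) + ENNReal.ofReal (1 / (g + 1)) * f (i - 1) := by
  rw [tsum_eq_sum (s := {i + 1, i - 1}), Finset.sum_pair (by omega)]
  · simp only [biasedTransition, if_true]
    rw [if_neg (by omega)]
  · intro j hj
    simp only [Finset.mem_insert, Finset.mem_singleton, not_or] at hj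
    simp [biasedTransition, hj.1, hj.2]

theorem ofReal_biased_add (hg : 0 ≤ g) :
    ENNReal.ofReal (g / (g + 1)) + ENNReal.ofReal (1 / (g + 1)) = 1 := by
  rw [← ENNReal.ofReal_add (by positivity) (by positivity), ← add_div, div_self (by positivity),
    ENNReal.ofReal_one]

theorem tsum_biasedTransition (hg : 0 ≤ g) (i : ℤ) : ∑' j, biasedTransition g i j = 1 := by
  have := tsum_biasedTransition_mul (g := g) i fun _ => 1
  simpa only [mul_one, ofReal_biased_add hg] using this

/-- The hypothesis `h` says that `j ↦ m ^ j` is a subsolution, `j` being the distance left to `n`.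
Since it is at most 1, truncation after `k` steps costs at most `s ^ k`. -/
theorem ofReal_pow_le_discHit_biased (hg : 0 ≤ g) {s m : ℝ} (hs : 0 ≤ s) (hm0 : 0 ≤ m)
    (hm1 : m ≤ 1) (h : (g + 1) * m ≤ s * (g + m ^ 2)) (n : ℤ) (k j : ℕ) :
    ENNReal.ofReal (m ^ j) ≤
      discHit (biasedTransition g) {n} (ENNReal.ofReal s) k (n - j) + ENNReal.ofReal s ^ k := by
  induction k generalizing j with
  | zero =>
    rw [pow_zero]
    exact le_add_left (ENNReal.ofReal_le_one.2 (pow_le_one₀ hm0 hm1))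
  | succ k ih =>
    cases j with
    | zero => simp [discHit]
    | succ j =>
      have hne : n - ((j + 1 : ℕ) : ℤ) ∉ ({n} : Set ℤ) := by
        rw [Set.mem_singleton_iff]; push_cast; omega
      rw [discHit, if_neg hne, tsum_biasedTransition_mul]
      have e1 : n - ((j + 1 : ℕ) : ℤ) + 1 = n - (j : ℕ) := by push_cast; ring
      have e2 : n - ((j + 1 : ℕ) : ℤ) - 1 = n - (j + 2 : ℕ) := by push_cast; ring
      rw [e1, e2]
      have hle : m ^ (j + 1) ≤ s * (g / (g + 1) * m ^ j + 1 / (g + 1) * m ^ (j + 2)) := by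
        have e : s * (g / (g + 1) * m ^ j + 1 / (g + 1) * m ^ (j + 2)) =
            m ^ j * (s * (g + m ^ 2)) / (g + 1) := by
          field_simp
          ring
        rw [e, le_div_iff₀ (by positivity)]
        calc m ^ (j + 1) * (g + 1) = m ^ j * ((g + 1) * m) := by ring
          _ ≤ _ := by gcongr
      refine (ENNReal.ofReal_le_ofReal hle).trans ?_
      rw [ENNReal.ofReal_mul hs, ENNReal.ofReal_add (by positivity) (by positivity),
        ENNReal.ofReal_mul (by positivity), ENNReal.ofReal_mul (by positivity)]
      calc _ ≤ ENNReal.ofReal s * (ENNReal.ofReal (g / (g + 1)) *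
            (discHit (biasedTransition g) {n} (ENNReal.ofReal s) k (n - j) + ENNReal.ofReal s ^ k)
            + ENNReal.ofReal (1 / (g + 1)) *
            (discHit (biasedTransition g) {n} (ENNReal.ofReal s) k (n - (j + 2 : ℕ))
              + ENNReal.ofReal s ^ k)) := by
              gcongr
              · exact ih j
              · exact ih (j + 2)
        _ = ENNReal.ofReal s * (ENNReal.ofReal (g / (g + 1)) *
              discHit (biasedTransition g) {n} (ENNReal.ofReal s) k (n - j)
            + ENNReal.ofReal (1 / (g + 1)) *
              discHit (biasedTransition g) {n} (ENNReal.ofReal s) k (n - (j + 2 : ℕ)))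
            + (ENNReal.ofReal (g / (g + 1)) + ENNReal.ofReal (1 / (g + 1)))
              * ENNReal.ofReal s ^ (k + 1) := by ring
        _ = _ := by rw [ofReal_biased_add hg, one_mul]

theorem ofReal_pow_le_iSup_discHit_biased (hg : 0 ≤ g) {s m : ℝ} (hs : 0 ≤ s) (hs1 : s < 1)
    (hm0 : 0 ≤ m) (hm1 : m ≤ 1) (h : (g + 1) * m ≤ s * (g + m ^ 2)) (n : ℕ) :
    ENNReal.ofReal (m ^ n) ≤
      ⨆ k, discHit (biasedTransition g) {(n : ℤ)} (ENNReal.ofReal s) k 0 := by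
  have hlim : Filter.Tendsto (fun k : ℕ =>
      (⨆ k, discHit (biasedTransition g) {(n : ℤ)} (ENNReal.ofReal s) k 0)
        + ENNReal.ofReal s ^ k) Filter.atTop
      (nhds ((⨆ k, discHit (biasedTransition g) {(n : ℤ)} (ENNReal.ofReal s) k 0) + 0)) :=
    tendsto_const_nhds.add
      (ENNReal.tendsto_pow_atTop_nhds_zero_of_lt_one (by rwa [ENNReal.ofReal_lt_one]))
  rw [add_zero] at hlim
  refine ge_of_tendsto' hlim fun k => ?_
  have := ofReal_pow_le_discHit_biased hg hs hm0 hm1 h n k n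
  rw [sub_self] at this
  refine this.trans ?_
  gcongr
  exact le_iSup (fun k => discHit (biasedTransition g) {(n : ℤ)} (ENNReal.ofReal s) k 0) k

end Biased

end

/-! ### Exhaustion by finite vertex sets -/

noncomputable section

section Restrict

variable {V : Type*}

/-- The transition probabilities of the chain killed outside `B`. -/
def restrictTransition (K : V → V → ℝ≥0∞) (B : Finset V) (x y : V) : ℝ≥0∞ :=
  open Classical in if y ∈ B then K x y else 0

variable {K : V → V → ℝ≥0∞} {A : Set V} {s : ℝ≥0∞}

theorem discHit_of_mem (k : ℕ) {x : V} (hx : x ∈ A) : discHit K A s k x = 1 := by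
  cases k <;> simp [discHit, hx]

theorem discHit_succ (k : ℕ) {x : V} (hx : x ∉ A) :
    discHit K A s (k + 1) x = s * ∑' y, K x y * discHit K A s k y := by
  rw [discHit, if_neg hx]

theorem discHit_le_one (hK : ∀ x, ∑' y, K x y ≤ 1) (hs : s ≤ 1) (k : ℕ) (x : V) :
    discHit K A s k x ≤ 1 := by
  induction k generalizing x with
  | zero => unfold discHit; split_ifs <;> simp
  | succ k ih =>
    unfold discHit
    split_ifs
    · rfl
    · refine mul_le_one' hs (le_trans ?_ (hK x))
      exact ENNReal.tsum_le_tsum fun y => mul_le_of_le_one_right' (ih y)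

theorem tsum_restrictTransition_mul (B : Finset V) (x : V) (f : V → ℝ≥0∞) :
    ∑' y, restrictTransition K B x y * f y = ∑ y ∈ B, K x y * f y := by
  rw [tsum_eq_sum (s := B)]
  · exact Finset.sum_congr rfl fun y hy => by rw [restrictTransition, if_pos hy]
  · intro y hy
    rw [restrictTransition, if_neg hy, zero_mul]

theorem discHit_restrict_mono {B C : Finset V} (h : B ⊆ C) (k : ℕ) (x : V) :
    discHit (restrictTransition K B) A s k x ≤ discHit (restrictTransition K C) A s k x := by
  induction k generalizing x with
  | zero => exact le_rfl
  | succ k ih =>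
    by_cases hx : x ∈ A
    · rw [discHit_of_mem _ hx, discHit_of_mem _ hx]
    rw [discHit_succ _ hx, discHit_succ _ hx, tsum_restrictTransition_mul,
      tsum_restrictTransition_mul]
    gcongr
    exact (Finset.sum_le_sum fun y _ => mul_le_mul_right (ih y) _).trans
      (Finset.sum_le_sum_of_subset h)

/-- Monotone convergence at each step: finitely many next vertices suffice up to a supremum, and the
sets chosen for them can be united. -/
theorem discHit_le_iSup_restrict (k : ℕ) (x : V) :
    discHit K A s k x ≤ ⨆ B, discHit (restrictTransition K B) A s k x := by
  classical
  induction k generalizing x with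
  | zero => exact le_iSup_of_le ∅ le_rfl
  | succ k ih =>
    by_cases hx : x ∈ A
    · refine le_iSup_of_le ∅ ?_
      rw [discHit_of_mem _ hx, discHit_of_mem _ hx]
    rw [discHit_succ _ hx, ENNReal.tsum_eq_iSup_sum, ENNReal.mul_iSup]
    refine iSup_le fun F => ?_
    calc s * ∑ y ∈ F, K x y * discHit K A s k y
        ≤ s * ∑ y ∈ F, ⨆ B, K x y * discHit (restrictTransition K B) A s k y := by
          gcongr with y
          rw [← ENNReal.mul_iSup]
          gcongr
          exact ih y
      _ = ⨆ B, s * ∑ y ∈ F, K x y * discHit (restrictTransition K B) A s k y := by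
          rw [ENNReal.finsetSum_iSup_of_monotone, ENNReal.mul_iSup]
          intro y B C hBC
          exact mul_le_mul_right (discHit_restrict_mono hBC k y) _
      _ ≤ _ := by
          refine iSup_le fun B => le_iSup_of_le (F ∪ B) ?_
          rw [discHit_succ _ hx, tsum_restrictTransition_mul]
          gcongr
          refine (Finset.sum_le_sum fun y _ => mul_le_mul_right
            (discHit_restrict_mono Finset.subset_union_right k y) _).trans
            (Finset.sum_le_sum_of_subset Finset.subset_union_left)

end Restrict

namespace WeightedGraph

variable {V : Type*} (G : WeightedGraph V)

theorem vertexWeight_ne_top (x : V) : G.vertexWeight x ≠ ⊤ := G.sum_ne_top x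

theorem weight_le_vertexWeight (x y : V) : (G.weight x y : ℝ≥0∞) ≤ G.vertexWeight x :=
  ENNReal.le_tsum y

theorem weight_eq_zero {y : V} (h : G.vertexWeight y = 0) (x : V) : G.weight x y = 0 := by
  have := G.weight_le_vertexWeight y x
  rw [h, G.symm] at this
  simpa using this

theorem tsum_transition (x : V) :
    ∑' y, G.transition x y = G.vertexWeight x / G.vertexWeight x := by
  simp only [transition, div_eq_mul_inv, ENNReal.tsum_mul_right]
  rfl

theorem sum_weight_le (x : V) (B : Finset V) :
    ∑ y ∈ B, (G.weight x y : ℝ) ≤ (G.vertexWeight x).toReal := by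
  rw [← ENNReal.ofReal_le_iff_le_toReal (G.vertexWeight_ne_top x),
    ENNReal.ofReal_sum_of_nonneg fun y _ => NNReal.coe_nonneg _]
  simp only [ENNReal.ofReal_coe_nnreal]
  exact ENNReal.sum_le_tsum B

/-- The vertices of `B` outside the target at which the walk can be. -/
def interior (z : Set V) (B : Finset V) : Finset V :=
  open Classical in B.filter fun y => y ∉ z ∧ G.vertexWeight y ≠ 0

/-- The part of the target inside `B`. -/
def boundary (z : Set V) (B : Finset V) : Finset V := open Classical in B.filter fun y => y ∈ z

variable {G} in
theorem mem_interior {z : Set V} {B : Finset V} {x : V} :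
    x ∈ G.interior z B ↔ x ∈ B ∧ x ∉ z ∧ G.vertexWeight x ≠ 0 := by
  simp [interior]

theorem mem_boundary {z : Set V} {B : Finset V} {x : V} :
    x ∈ boundary z B ↔ x ∈ B ∧ x ∈ z := by
  simp [boundary]

/-- The network of the walk killed outside the finite set `B`, with target `z`. -/
def killed (z : Set V) (B : Finset V) : KilledNetwork (G.interior z B) where
  c x y := G.weight x y
  c_nonneg x y := (G.weight x y).2
  c_symm x y := by rw [G.symm]
  W x := (G.vertexWeight x).toReal
  W_pos x := ENNReal.toReal_pos (mem_interior.1 x.2).2.2 (G.vertexWeight_ne_top x)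
  b x := ∑ y ∈ boundary z B, (G.weight x y : ℝ)
  b_nonneg x := Finset.sum_nonneg fun y _ => (G.weight x y).2
  sum_le x := by
    classical
    rw [Finset.sum_coe_sort (G.interior z B) fun y => (G.weight x y : ℝ),
      ← Finset.sum_union]
    · exact G.sum_weight_le x _
    · exact Finset.disjoint_left.2 fun y h1 h2 => (mem_interior.1 h1).2.1 (mem_boundary.1 h2).2

theorem ofReal_sum_b_le (z : Set V) (B : Finset V) :
    ENNReal.ofReal (∑ x, (G.killed z B).b x) ≤ G.setWeight z := by
  classical
  have h1 : ∑ x, (G.killed z B).b x ≤ ∑ y ∈ boundary z B, (G.vertexWeight y).toReal := by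
    simp only [killed]
    rw [Finset.sum_comm]
    refine Finset.sum_le_sum fun y _ => ?_
    rw [Finset.sum_coe_sort (G.interior z B) fun x => (G.weight x y : ℝ)]
    simp only [G.symm _ y]
    exact G.sum_weight_le y _
  refine (ENNReal.ofReal_le_ofReal h1).trans ?_
  rw [ENNReal.ofReal_sum_of_nonneg fun y _ => ENNReal.toReal_nonneg]
  simp only [ENNReal.ofReal_toReal (G.vertexWeight_ne_top _)]
  rw [setWeight, tsum_subtype z G.vertexWeight]
  refine le_trans (le_of_eq ?_) (ENNReal.sum_le_tsum (boundary z B))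
  exact Finset.sum_congr rfl fun y hy =>
    (Set.indicator_of_mem (mem_boundary.1 hy).2 _).symm

theorem edist_le_add_one {x y : V} (o : V) (h : G.weight x y ≠ 0) :
    G.graph.edist o y ≤ G.graph.edist o x + 1 := by
  by_cases hxy : x = y
  · subst hxy; exact le_self_add
  have hadj : G.graph.Adj x y := ⟨hxy, h⟩
  refine (SimpleGraph.edist_triangle (v := x)).trans ?_
  rw [SimpleGraph.edist_eq_one_iff_adj.2 hadj]

/-- The graph distance from `o` truncated at `n`. -/
def truncDist (o : V) (n : ℕ) (x : V) : ℕ := (min (G.graph.edist o x) n).toNat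

theorem coe_truncDist (o : V) (n : ℕ) (x : V) :
    (G.truncDist o n x : ℕ∞) = min (G.graph.edist o x) n :=
  ENat.natCast_toNat (ne_top_of_le_ne_top (ENat.natCast_ne_top n) (min_le_right _ _))

/-- A vertex adjacent to `z` is at distance at least `n`, so truncation at `n` makes the distance
exactly `n` there; the last unit of distance is the step into `z`. -/
theorem isDist_killed {o : V} {z : Set V} {n : ℕ}
    (hdist : ∀ y ∈ z, (n + 1 : ℕ∞) ≤ G.graph.edist o y) {B : Finset V}
    (ho : o ∈ G.interior z B) :
    (G.killed z B).IsDist ⟨o, ho⟩ n fun x => G.truncDist o n x where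
  pole := by simp [truncDist]
  nonneg x := by positivity
  sub_le x y h := by
    have hw : G.weight y x ≠ 0 := by
      rw [G.symm]
      simpa [killed] using h
    have h1 := G.edist_le_add_one o hw
    have h2 : (G.truncDist o n x : ℕ∞) ≤ (G.truncDist o n y + 1 : ℕ) := by
      push_cast
      rw [coe_truncDist, coe_truncDist, ← min_add_add_right]
      exact le_min ((min_le_left _ _).trans h1) ((min_le_right _ _).trans le_self_add)
    exact_mod_cast h2
  target x h := by
    obtain ⟨y, hy, hxy⟩ := Finset.exists_ne_zero_of_sum_ne_zero h
    have h1 := (hdist y (mem_boundary.1 hy).2).trans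
      (G.edist_le_add_one o (by simpa using hxy : G.weight x y ≠ 0))
    have h2 : (n : ℕ∞) ≤ G.graph.edist o x :=
      (ENat.add_le_add_iff_right ENat.one_ne_top).1 h1
    have h3 : (G.truncDist o n x : ℕ∞) = n := by rw [coe_truncDist, min_eq_right h2]
    exact_mod_cast h3

/-- The iteration is monotone, starts below `φ` and has `φ`, extended by 1 on `z`, as a fixed point.
Vertices of weight zero, absent from the network, are never entered. -/
theorem discHit_killed_le {z : Set V} {B : Finset V} {s : ℝ} (hs0 : 0 < s) (hs1 : s < 1)
    {φ : G.interior z B → ℝ} (hφ : (G.killed z B).IsHit s φ) (k : ℕ) (x : G.interior z B) :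
    discHit (restrictTransition G.transition B) z (ENNReal.ofReal s) k x ≤
      ENNReal.ofReal (φ x) := by
  classical
  induction k generalizing x with
  | zero => simp [discHit, (mem_interior.1 x.2).2.1]
  | succ k ih =>
    have hφ0 := hφ.nonneg hs0.le hs1
    have hW : 0 < (G.vertexWeight x).toReal := (G.killed z B).W_pos x
    set Φ : V → ℝ := fun y => if y ∈ z then 1 else
      if hy : y ∈ G.interior z B then φ ⟨y, hy⟩ else 0 with hΦ
    have hΦ0 : ∀ y, 0 ≤ Φ y := fun y => by
      simp only [hΦ]
      split_ifs
      · exact zero_le_one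
      · exact hφ0 _
      · exact le_rfl
    rw [discHit_succ _ (mem_interior.1 x.2).2.1, tsum_restrictTransition_mul]
    have hterm : ∀ y ∈ B, G.transition x y *
        discHit (restrictTransition G.transition B) z (ENNReal.ofReal s) k y ≤
        ENNReal.ofReal (G.weight x y * Φ y / (G.vertexWeight x).toReal) := by
      intro y hy
      have htr : G.transition x y =
          ENNReal.ofReal (G.weight x y / (G.vertexWeight x).toReal) := by
        rw [ENNReal.ofReal_div_of_pos hW, ENNReal.ofReal_toReal (G.vertexWeight_ne_top x),
          ENNReal.ofReal_coe_nnreal, transition]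
      have e : (G.weight x y : ℝ) * Φ y / (G.vertexWeight x).toReal =
          G.weight x y / (G.vertexWeight x).toReal * Φ y := by ring
      rw [e, ENNReal.ofReal_mul (by positivity), ← htr]
      by_cases hyz : y ∈ z
      · rw [discHit_of_mem _ hyz]
        simp [hΦ, hyz]
      by_cases hyI : y ∈ G.interior z B
      · gcongr
        simp only [hΦ, hyz, if_false, hyI, dif_pos]
        exact ih ⟨y, hyI⟩
      · have hy0 : G.vertexWeight y = 0 := by
          by_contra h
          exact hyI (mem_interior.2 ⟨hy, hyz, h⟩)
        simp [transition, G.weight_eq_zero hy0]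
    have hsplit : ∑ y ∈ B, (G.weight x y : ℝ) * Φ y =
        ∑ y, (G.killed z B).c x y * φ y + (G.killed z B).b x := by
      rw [← Finset.sum_filter_add_sum_filter_not B (fun y => y ∈ z), add_comm]
      congr 1
      · have hc : ∑ y, (G.killed z B).c x y * φ y =
            ∑ y : G.interior z B, (G.weight x y : ℝ) * Φ y :=
          Finset.sum_congr rfl fun y _ => by
            simp [hΦ, (mem_interior.1 y.2).2.1, y.2, killed]
        rw [hc, Finset.sum_coe_sort (G.interior z B) fun y => (G.weight x y : ℝ) * Φ y]
        symm
        refine Finset.sum_subset (fun y hy => ?_) fun y hy hyI => ?_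
        · exact Finset.mem_filter.2 ⟨(mem_interior.1 hy).1, (mem_interior.1 hy).2.1⟩
        · simp [hΦ, hyI, (Finset.mem_filter.1 hy).2]
      · simp only [killed]
        refine Finset.sum_congr ?_ fun y hy => ?_
        · ext y; simp [mem_boundary]
        · simp [hΦ, (mem_boundary.1 hy).2]
    calc _ ≤ ENNReal.ofReal s *
          ∑ y ∈ B, ENNReal.ofReal (G.weight x y * Φ y / (G.vertexWeight x).toReal) := by
          gcongr with y hy
          exact hterm y hy
      _ = ENNReal.ofReal (s * ∑ y ∈ B, G.weight x y * Φ y / (G.vertexWeight x).toReal) := by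
          rw [ENNReal.ofReal_mul hs0.le, ENNReal.ofReal_sum_of_nonneg]
          exact fun y _ => div_nonneg (mul_nonneg (G.weight x y).2 (hΦ0 y)) hW.le
      _ = ENNReal.ofReal (φ x) := by
          rw [← Finset.sum_div, hsplit]
          congr 1
          have := hφ.W_mul x
          have hWx : (G.killed z B).W x = (G.vertexWeight x).toReal := rfl
          rw [hWx] at this
          field_simp
          linarith

end WeightedGraph

end

/-! ### Green function and effective resistance -/

noncomputable section

namespace WeightedGraph

variable {V : Type*} (G : WeightedGraph V)

/-- The energy of a finitely supported nonnegative function. -/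
theorem energy_le_ofReal {I : Finset V} {f : V → ℝ} (hf : ∀ x, 0 ≤ f x) (hI : ∀ x ∉ I, f x = 0) :
    G.energy f ≤ ENNReal.ofReal (∑ x ∈ I, (G.vertexWeight x).toReal * f x ^ 2
      - ∑ x ∈ I, ∑ y ∈ I, G.weight x y * (f x * f y)) := by
  set a := ∑' x, ∑' y, (G.weight x y : ℝ≥0∞) * ENNReal.ofReal ((f x - f y) ^ 2) with ha
  set T := ∑ x ∈ I, (G.vertexWeight x).toReal * f x ^ 2 with hT
  set E := ∑ x ∈ I, ∑ y ∈ I, (G.weight x y : ℝ) * (f x * f y) with hE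
  have hE0 : 0 ≤ E := Finset.sum_nonneg fun x _ => Finset.sum_nonneg fun y _ =>
    mul_nonneg (NNReal.coe_nonneg _) (mul_nonneg (hf x) (hf y))
  have hT0 : 0 ≤ T := Finset.sum_nonneg fun x _ =>
    mul_nonneg ENNReal.toReal_nonneg (sq_nonneg _)
  have h1 : ∑' x, ∑' y, (G.weight x y : ℝ≥0∞) * ENNReal.ofReal (f x ^ 2) =
      ENNReal.ofReal T := by
    simp only [ENNReal.tsum_mul_right]
    rw [tsum_eq_sum (s := I), hT, ENNReal.ofReal_sum_of_nonneg]
    · refine Finset.sum_congr rfl fun x _ => ?_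
      rw [ENNReal.ofReal_mul ENNReal.toReal_nonneg,
        ENNReal.ofReal_toReal (G.vertexWeight_ne_top x)]
      rfl
    · exact fun x _ => mul_nonneg ENNReal.toReal_nonneg (sq_nonneg _)
    · intro x hx
      simp [hI x hx]
  have h2 : ∑' x, ∑' y, (G.weight x y : ℝ≥0∞) * ENNReal.ofReal (f y ^ 2) =
      ENNReal.ofReal T := by
    rw [ENNReal.tsum_comm, ← h1]
    simp only [G.symm]
  have h3 : ∑' x, ∑' y, (G.weight x y : ℝ≥0∞) * ENNReal.ofReal (2 * (f x * f y)) =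
      ENNReal.ofReal (2 * E) := by
    rw [tsum_eq_sum (s := I), hE, Finset.mul_sum, ENNReal.ofReal_sum_of_nonneg]
    · refine Finset.sum_congr rfl fun x _ => ?_
      rw [tsum_eq_sum (s := I), Finset.mul_sum, ENNReal.ofReal_sum_of_nonneg]
      · refine Finset.sum_congr rfl fun y _ => ?_
        rw [mul_left_comm (2 : ℝ) (G.weight x y : ℝ), ENNReal.ofReal_mul (NNReal.coe_nonneg _), ENNReal.ofReal_coe_nnreal]
      · exact fun y _ => mul_nonneg zero_le_two
          (mul_nonneg (NNReal.coe_nonneg _) (mul_nonneg (hf x) (hf y)))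
      · intro y hy
        simp [hI y hy]
    · exact fun x _ => mul_nonneg zero_le_two (Finset.sum_nonneg fun y _ =>
          mul_nonneg (NNReal.coe_nonneg _) (mul_nonneg (hf x) (hf y)))
    · intro x hx
      simp [hI x hx]
  -- The square is expanded with the cross term on the left, because subtraction in `ℝ≥0∞` is
  -- truncated.
  have hsum : a + ENNReal.ofReal (2 * E) = ENNReal.ofReal (2 * T) := by
    rw [two_mul T, ENNReal.ofReal_add hT0 hT0]
    nth_rewrite 1 [← h1]
    rw [← h2, ← h3, ha, ← ENNReal.tsum_add, ← ENNReal.tsum_add]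
    refine tsum_congr fun x => ?_
    rw [← ENNReal.tsum_add, ← ENNReal.tsum_add]
    refine tsum_congr fun y => ?_
    rw [← mul_add, ← mul_add, ← ENNReal.ofReal_add (sq_nonneg _)
      (mul_nonneg zero_le_two (mul_nonneg (hf x) (hf y))),
      ← ENNReal.ofReal_add (sq_nonneg _) (sq_nonneg _)]
    congr 2
    ring
  have ha' : a = ENNReal.ofReal (2 * T - 2 * E) := by
    rw [ENNReal.ofReal_sub _ (by positivity)]
    exact ENNReal.eq_sub_of_add_eq ENNReal.ofReal_ne_top hsum
  have e : G.energy f = a / 2 := rfl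
  rw [e, ha', ← mul_sub, ENNReal.ofReal_mul zero_le_two]
  refine ENNReal.div_le_of_le_mul ?_
  rw [mul_comm]
  simp

/-- The competitor is `u / u o`. Its finite support makes it admissible for the wired resistance as
well as for the free one. -/
theorem exists_energy_le {o : V} {z : Set V} {B : Finset V} (ho : o ∈ G.interior z B) {s : ℝ}
    (hs0 : 0 < s) (hs1 : s < 1) {u : G.interior z B → ℝ}
    (hu : (G.killed z B).IsGreen s ⟨o, ho⟩ u) :
    ∃ f : V → ℝ, f o = 1 ∧ (∀ y ∈ z, f y = 0) ∧ {x | f x ≠ 0}.Finite ∧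
      G.energy f ≤ (ENNReal.ofReal (u ⟨o, ho⟩))⁻¹ := by
  classical
  have hpole := hu.pole_pos hs0.le hs1
  have hu0 := hu.nonneg hs0.le hs1
  set f : V → ℝ := fun x => if hx : x ∈ G.interior z B then u ⟨x, hx⟩ / u ⟨o, ho⟩ else 0 with hf
  have hfI : ∀ x : G.interior z B, f x = u x / u ⟨o, ho⟩ := fun x => by simp [hf]
  have hf0 : ∀ x, 0 ≤ f x := fun x => by
    simp only [hf]
    split_ifs
    · exact div_nonneg (hu0 _) hpole.le
    · rfl
  have hfout : ∀ x ∉ G.interior z B, f x = 0 := fun x hx => by simp [hf, hx]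
  refine ⟨f, ?_, fun y hy => hfout y fun h => (mem_interior.1 h).2.1 hy, ?_, ?_⟩
  · simp [hf, ho, hpole.ne']
  · refine (G.interior z B).finite_toSet.subset fun x hx => ?_
    by_contra h
    exact hx (hfout x h)
  refine (G.energy_le_ofReal hf0 hfout).trans ?_
  rw [← ENNReal.ofReal_inv_of_pos hpole]
  refine ENNReal.ofReal_le_ofReal ?_
  have hg := hu.sum_mul_op u
  have hE : 0 ≤ ∑ x ∈ G.interior z B, ∑ y ∈ G.interior z B, (G.weight x y : ℝ) * (f x * f y) :=
    Finset.sum_nonneg fun x _ => Finset.sum_nonneg fun y _ =>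
      mul_nonneg (NNReal.coe_nonneg _) (mul_nonneg (hf0 x) (hf0 y))
  have key : ∑ x ∈ G.interior z B, (G.vertexWeight x).toReal * f x ^ 2
      - s * ∑ x ∈ G.interior z B, ∑ y ∈ G.interior z B, (G.weight x y : ℝ) * (f x * f y) =
      (u ⟨o, ho⟩)⁻¹ := by
    have e1 : (u ⟨o, ho⟩)⁻¹ = (∑ x, u x * (G.killed z B).op s u x) / u ⟨o, ho⟩ ^ 2 := by
      rw [hg]; field_simp
    rw [e1, Finset.sum_div, Finset.mul_sum, ← Finset.sum_sub_distrib,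
      ← Finset.sum_coe_sort (G.interior z B)]
    refine Finset.sum_congr rfl fun x _ => ?_
    rw [← Finset.sum_coe_sort (G.interior z B)]
    have e2 : ∑ y : G.interior z B, (G.weight x y : ℝ) * (f x * f y) =
        u x / u ⟨o, ho⟩ ^ 2 * ∑ y, (G.killed z B).c x y * u y := by
      rw [Finset.mul_sum]
      refine Finset.sum_congr rfl fun y _ => ?_
      rw [hfI, hfI]
      simp only [killed]
      field_simp
    rw [e2, hfI]
    have hWx : (G.killed z B).W x = (G.vertexWeight x).toReal := rfl
    simp only [KilledNetwork.op, hWx]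
    field_simp
  -- The energy bound is `(u o)⁻¹` minus `1 - s` times the nonnegative cross term.
  nlinarith

theorem ofReal_green_le_resistance {o : V} {z : Set V} {B : Finset V}
    (ho : o ∈ G.interior z B) {s : ℝ} (hs0 : 0 < s) (hs1 : s < 1) {u : G.interior z B → ℝ}
    (hu : (G.killed z B).IsGreen s ⟨o, ho⟩ u) {r : ℝ≥0∞}
    (hr : r = G.freeResistance o z ∨ r = G.wiredResistance o z) :
    ENNReal.ofReal (u ⟨o, ho⟩) ≤ r := by
  obtain ⟨f, hfo, hfz, hfin, hE⟩ := G.exists_energy_le ho hs0 hs1 hu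
  rw [← inv_inv (ENNReal.ofReal (u ⟨o, ho⟩))]
  rcases hr with rfl | rfl
  · exact ENNReal.inv_le_inv.2 ((iInf₂_le f ⟨hfo, hfz⟩).trans hE)
  · exact ENNReal.inv_le_inv.2 ((iInf₂_le f ⟨hfo, hfz, 0, hfin⟩).trans hE)

theorem stepBound_killed {o : V} {z : Set V} {n : ℕ} (hn : n ≠ 0)
    (hdist : ∀ y ∈ z, (n + 1 : ℕ∞) ≤ G.graph.edist o y) {g : ℝ}
    (hg : (1 < g ∧ ENNReal.ofReal ((g - 1) ^ 2 * g ^ ((n : ℤ) - 2))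
          = 2 * G.setWeight z / G.vertexWeight o) ∨
      (∃ r : ℝ≥0∞, (r = G.freeResistance o z ∨ r = G.wiredResistance o z) ∧
        G.setWeight z * r ≠ ⊤ ∧ g = (G.setWeight z * r).toReal ^ (1 / (n : ℝ))))
    {B : Finset V} (ho : o ∈ G.interior z B) : (G.killed z B).StepBound ⟨o, ho⟩ n g := by
  have hd := G.isDist_killed hdist ho
  have hbz := G.ofReal_sum_b_le z B
  have hb0 : 0 ≤ ∑ x, (G.killed z B).b x :=
    Finset.sum_nonneg fun x _ => (G.killed z B).b_nonneg x
  rcases hg with ⟨hg1, hg⟩ | ⟨r, hr, hfin, rfl⟩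
  · refine KilledNetwork.stepBound_of_weight hn hd hg1 ?_
    have hg0 : 0 < g := by linarith
    have hwo := (mem_interior.1 ho).2.2
    have hpow : g ^ ((n : ℤ) - 2) * g ^ 2 = g ^ n := by
      rw [← zpow_natCast g 2, ← zpow_add₀ hg0.ne', ← zpow_natCast g n]
      norm_num
    have h1 : 2 * G.setWeight z =
        ENNReal.ofReal ((g - 1) ^ 2 * g ^ ((n : ℤ) - 2)) * G.vertexWeight o := by
      rw [hg, ENNReal.div_mul_cancel hwo (G.vertexWeight_ne_top o)]
    have h2 : ENNReal.ofReal (2 * ∑ x, (G.killed z B).b x) ≤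
        ENNReal.ofReal ((g - 1) ^ 2 * g ^ ((n : ℤ) - 2) * (G.vertexWeight o).toReal) := by
      rw [ENNReal.ofReal_mul zero_le_two, ENNReal.ofReal_mul (by positivity),
        ENNReal.ofReal_toReal (G.vertexWeight_ne_top o), ← h1]
      simpa using mul_le_mul_right hbz 2
    have h3 := (ENNReal.ofReal_le_ofReal_iff (by positivity)).1 h2
    have hWo : (G.killed z B).W ⟨o, ho⟩ = (G.vertexWeight o).toReal := rfl
    rw [hWo, ← hpow]
    nlinarith [mul_le_mul_of_nonneg_right h3 (sq_nonneg g)]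
  · refine KilledNetwork.stepBound_of_resistance hn hd (by positivity) fun s u hs0 hs1 hu => ?_
    have hn' : (n : ℝ) ≠ 0 := by exact_mod_cast hn
    rw [← Real.rpow_natCast, ← Real.rpow_mul ENNReal.toReal_nonneg, one_div,
      inv_mul_cancel₀ hn', Real.rpow_one, ← ENNReal.ofReal_le_iff_le_toReal hfin,
      ENNReal.ofReal_mul hb0]
    exact mul_le_mul' hbz (G.ofReal_green_le_resistance ho hs0 hs1 hu hr)

/-- The row of a vertex of weight zero sums to 0 and not to 1, but such a vertex is neither the
start nor ever entered. -/
theorem isStochasticAlong_transition {o : V} (ho : G.vertexWeight o ≠ 0) {Ω : Type*}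
    [MeasurableSpace Ω] {P : Measure Ω} {X : ℕ → Ω → V} (hX : IsMarkovChain P G.transition o X) :
    IsStochasticAlong P G.transition X := by
  intro j x hP
  rw [tsum_transition]
  refine ENNReal.div_self ?_ (G.vertexWeight_ne_top _)
  cases j with
  | zero =>
    suffices x 0 = o by rwa [this]
    by_contra hne
    refine hP (measure_mono_null (fun ω hω => ?_) hX.start)
    intro h
    exact hne ((hω 0 le_rfl).symm.trans h)
  | succ j =>
    intro h0
    rw [hX.step, transition, G.weight_eq_zero h0] at hP
    simp at hP

theorem discHit_le_biased {o : V} {z : Set V} {n : ℕ} (hn : n ≠ 0)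
    (ho : G.vertexWeight o ≠ 0) (hoz : o ∉ z)
    (hdist : ∀ y ∈ z, (n + 1 : ℕ∞) ≤ G.graph.edist o y) {g : ℝ} (hg0 : 0 ≤ g)
    (hstep : ∀ B (hoB : o ∈ G.interior z B), (G.killed z B).StepBound ⟨o, hoB⟩ n g)
    {s : ℝ} (hs0 : 0 < s) (hs1 : s < 1) (k : ℕ) :
    discHit G.transition z (ENNReal.ofReal s) k o ≤ ENNReal.ofReal s *
      ⨆ k, discHit (biasedTransition g) {(n : ℤ)} (ENNReal.ofReal s) k 0 := by
  classical
  refine (discHit_le_iSup_restrict k o).trans (iSup_le fun B => ?_)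
  refine (discHit_restrict_mono (Finset.subset_insert o B) k o).trans ?_
  set C := insert o B
  have hoC : o ∈ G.interior z C := mem_interior.2 ⟨Finset.mem_insert_self _ _, hoz, ho⟩
  obtain ⟨φ, hφ'⟩ := (G.killed z C).exists_op_eq hs0.le hs1 fun x => s * (G.killed z C).b x
  have hφ : (G.killed z C).IsHit s φ := fun x => congrFun hφ' x
  refine (G.discHit_killed_le hs0 hs1 hφ k ⟨o, hoC⟩).trans ?_
  rcases (hφ.nonneg hs0.le hs1 ⟨o, hoC⟩).eq_or_lt with h0 | hpos
  · rw [← h0]; simp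
  obtain ⟨m, hm0, hm1, hφm, hm⟩ := KilledNetwork.exists_mean_step hn
    (G.isDist_killed hdist hoC) (hstep C hoC) hs0 hs1 hφ hpos
  rw [hφm, ENNReal.ofReal_mul hs0.le]
  gcongr
  exact ofReal_pow_le_iSup_discHit_biased hg0 hs0.le hs1 hm0.le hm1.le hm n

theorem discHit_le_discount {o : V} {z : Set V} (hoz : o ∉ z) {s : ℝ≥0∞} (hs : s ≤ 1) (k : ℕ) :
    discHit G.transition z s k o ≤ s := by
  have hK : ∀ x, ∑' y, G.transition x y ≤ 1 := fun x => by
    rw [tsum_transition]; exact ENNReal.div_self_le_one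
  cases k with
  | zero => simp [discHit, hoz]
  | succ k =>
    rw [discHit_succ _ hoz]
    refine mul_le_of_le_one_right' (le_trans ?_ (hK o))
    exact ENNReal.tsum_le_tsum fun y => mul_le_of_le_one_right' (discHit_le_one hK hs k y)

end WeightedGraph

end

theorem proposition2 {V : Type*} (G : WeightedGraph V) (o : V) (z : Set V) (n : ℕ)
    (ho : G.vertexWeight o ≠ 0)
    (hdist : ∀ y ∈ z, (n + 1 : ℕ∞) ≤ G.graph.edist o y)
    (g : ℝ)
    (hg :
      -- (a)
      (1 < g ∧ ENNReal.ofReal ((g - 1) ^ 2 * g ^ ((n : ℤ) - 2))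
          = 2 * G.setWeight z / G.vertexWeight o) ∨
      -- (b)
      (∃ r : ℝ≥0∞, (r = G.freeResistance o z ∨ r = G.wiredResistance o z) ∧
        G.setWeight z * r ≠ ⊤ ∧ g = (G.setWeight z * r).toReal ^ (1 / (n : ℝ))))
    -- the random walk on the weighted graph, started at `o`
    {Ω : Type*} [MeasurableSpace Ω] (P : Measure Ω) [IsProbabilityMeasure P]
    (X : ℕ → Ω → V) (hX : IsMarkovChain P G.transition o X)
    -- biased simple random walk on the integers, started at `0`
    {Ω' : Type*} [MeasurableSpace Ω'] (P' : Measure Ω') [IsProbabilityMeasure P']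
    (Y : ℕ → Ω' → ℤ) (hY : IsMarkovChain P' (biasedTransition g) 0 Y)
    (l : ℝ) (hl : 0 ≤ l) :
    laplace P (hittingTime X z) l ≤
      laplace P' (fun ω => hittingTime Y {(n : ℤ)} ω + 1) l := by
  have hoz : o ∉ z := fun h => by
    have := hdist o h
    simp at this
  have hg0 : 0 ≤ g := by
    rcases hg with ⟨h, -⟩ | ⟨r, -, -, rfl⟩
    · linarith
    · positivity
  have hKX := G.isStochasticAlong_transition ho hX
  have hKY : IsStochasticAlong P' (biasedTransition g) Y := fun j x _ =>
    tsum_biasedTransition hg0 (x j)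
  have hpos : ∀ l : ℝ, 0 < l → laplace P (hittingTime X z) l ≤
      Real.exp (-l) * laplace P' (hittingTime Y {(n : ℤ)}) l := by
    intro l hl
    have hs0 := Real.exp_pos (-l)
    have hs1 : Real.exp (-l) < 1 := by rw [Real.exp_lt_one_iff]; linarith
    have hL0 : 0 ≤ laplace P' (hittingTime Y {(n : ℤ)}) l :=
      integral_nonneg fun ω => expNeg_nonneg _ _
    refine (ENNReal.ofReal_le_ofReal_iff (mul_nonneg hs0.le hL0)).1 ?_
    rw [ENNReal.ofReal_mul hs0.le, hX.ofReal_laplace hKX z hl.le, hY.ofReal_laplace hKY _ hl.le]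
    refine iSup_le fun k => ?_
    -- For `n = 0` the biased walk is at its goal at once; it only matters that the other walk needs
    -- at least one step.
    by_cases hn : n = 0
    · subst hn
      refine (G.discHit_le_discount hoz (ENNReal.ofReal_le_one.2 hs1.le) k).trans
        (le_mul_of_one_le_right' (le_iSup_of_le 0 ?_))
      rw [discHit_of_mem _ (by simp)]
    · exact G.discHit_le_biased hn ho hoz hdist hg0
        (fun B hoB => G.stepBound_killed hn hdist hg hoB) hs0 hs1 k
  rw [laplace_add_one]
  -- At `λ = 0` both sides are limits from the right, by dominated convergence; the convention
  -- `e^{-0·∞} = 0` makes this true.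
  rcases hl.eq_or_lt with rfl | hl
  · have hcont : Continuous fun l : ℝ => Real.exp (-l) := by fun_prop
    refine le_of_tendsto_of_tendsto (hX.tendsto_laplace z)
      (((hcont.tendsto 0).mono_left nhdsWithin_le_nhds).mul
        (hY.tendsto_laplace {(n : ℤ)})) ?_
    filter_upwards [self_mem_nhdsWithin] with l hl
    exact hpos l hl
  · exact hpos l hl
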